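/- Let $\Gamma$ be an infinite, finitely generated, amenable group (i.e. the bounded real functions on $\Gamma$ carry a left-invariant mean), let $S$ be a finite symmetric generating set of $\Gamma$, and let $\mathcal G=(\Gamma,E)$ be the right Cayley graph (edges $[g,gs]$, $s\in S$, $g\neq gs$). Write $o$ for the identity. A *space with measured walls* $(X,\mathcal W,\mathcal B,\mu)$ is a set $X$ with a set $\mathcal W$ of partitions $\{A,A^c\}$ of $X$ (walls), a $\sigma$-algebra $\mathcal B$ on $\mathcal W$ and a measure $\mu$ on $\mathcal B$ such that for all $x,y\in X$ the set $\mathcal W(x,y)$ of walls separating $x$ and $y$ is measurable with $w(x,y):=\mu(\mathcal W(x,y))<\infty$. A $\Gamma$-action on $X$ is *invariant* if $W=\{B,B^c\}\mapsto gW=\{gB,gB^c\}$ defines an action on $\mathcal W$ by measurable, $\mu$-preserving maps; it is *proper* if it preserves $\mathcal W$ and $w$ and, for some $x_0\in X$, $w(x_0,gx_0)\to\infty$ as $g$ leaves every finite subset of $\Gamma$. Let $(K_n)_{n\ge1}$ be non-empty finite subsets of $\Gamma$ increasing to $\Gamma$ (such sequences exist). Then there is a sequence $(A_n)_{n\ge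 1}$ of non-empty finite subsets of $\Gamma$ with $|gA_n\Delta A_n|/|A_n|<2^{-n}$ for all $n\ge1$ and $g\in K_n$. Fix any such $(K_n)$ and $(A_n)$. For each $n$ equip $\Gamma$ with the walls $W_{n,g}=\{gA_n^{-1},(gA_n^{-1})^c\}$, $g\in\Gamma$, the power set $\sigma$-algebra, and the measure $\mu_n=\frac{n}{|A_n|}\sum_{g\in\Gamma}\delta_{W_{n,g}}$ (counting measure normalized by $n/|A_n|$, walls being counted with multiplicity), with wall distance $w_n(g,h)=\frac{n}{|A_n|}|gA_n\Delta hA_n|$. Let $(X,\mathcal W,\mathcal B,\mu)$ be the product of these spaces pointed at $o$: $X=\{x\in\Gamma^{\mathbb N}:\sum_n w_n(o,x_n)<\infty\}$, the walls are the pull-backs of the walls $W_{n,g}$ under the coordinate projections $X\to\Gamma$, a set of walls is measurable if for each $n$ its part coming from the $n$-th factor is measurable there, and $\mu$ is the sum of the images of the $\mu_n$. Let $\Gamma$ act on $X$ diagonally and put $x_0=(o,o,\dots)$. Then: 1. $(X,\mathcal W,\mathcal B,\mu)$ is a space with measured walls and the action of $\Gamma$ on it is well defined, invariant and proper. 2.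 For every $p\in(0,1)$ there exists a Poisson process on $\mathcal W$ with intensity $(1-p)\mu$. For every such process $\eta_p$, let $\omega_p$ consist of those edges $[g,h]\in E$ with $\eta_p(\mathcal W(gx_0,hx_0))=0$. Then $\omega_p$ is a $\Gamma$-invariant bond percolation on $\mathcal G$, and almost surely $\omega_p$ has no infinite cluster (connected component of the graph with vertex set $\Gamma$ and edge set $\omega_p$). 3. For every $\alpha<1$ there is $p\in(0,1)$ such that $\mathbb E[\deg_{\omega_p}(o)]>\alpha\deg_{\mathcal G}(o)$. In particular, for every $\alpha<1$ this construction yields a $\Gamma$-invariant bond percolation on $\mathcal G$ with no infinite clusters and with $\mathbb E[\deg_\omega(o)]>\alpha\deg(o)$, which is the constructive direction of the Benjamini–Lyons–Peres–Schramm amenability criterion. -/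

import Mathlib

open MeasureTheory ProbabilityTheory Filter Topology Set
open scoped ENNReal NNReal Pointwise symmDiff

universe u v

/-! ## Amenability and Følner sequences -/

/-- A discrete group is amenable if the bounded real functions on it carry a left-invariant mean:
a positive, normalised, left-invariant linear functional. (The values of `m` on unbounded functions
play no role.) -/
def IsAmenable (Γ : Type*) [Group Γ] : Prop :=
  ∃ m : (Γ → ℝ) → ℝ,
    (∀ f₁ f₂ : Γ → ℝ, (∃ C, ∀ x, |f₁ x| ≤ C) → (∃ C, ∀ x, |f₂ x| ≤ C) →
      m (fun x => f₁ x + f₂ x) = m f₁ + m f₂) ∧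
    (∀ (c : ℝ) (f : Γ → ℝ), (∃ C, ∀ x, |f x| ≤ C) → m (fun x => c * f x) = c * m f) ∧
    (∀ f : Γ → ℝ, (∃ C, ∀ x, |f x| ≤ C) → (∀ x, 0 ≤ f x) → 0 ≤ m f) ∧
    m (fun _ => 1) = 1 ∧
    (∀ (g : Γ) (f : Γ → ℝ), (∃ C, ∀ x, |f x| ≤ C) → m (fun x => f (g⁻¹ * x)) = m f)

/-- A sequence of non-empty finite sets increasing to the whole group. -/
structure IsExhaustion {Γ : Type*} (K : ℕ+ → Finset Γ) : Prop where
  nonempty : ∀ n, (K n).Nonempty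
  mono : Monotone K
  exhausts : ∀ g, ∃ n, g ∈ K n

/-- An exhaustion `(K n)` together with a Følner sequence `(A n)` for it: the sets `A n` are finite
and non-empty and `|g (A n) ∆ A n| / |A n| < 2 ^ (-n)` for every `g ∈ K n`. -/
structure FolnerSequence (Γ : Type*) [Group Γ] where
  K : ℕ+ → Finset Γ
  isExhaustion : IsExhaustion K
  A : ℕ+ → Finset Γ
  A_nonempty : ∀ n, (A n).Nonempty
  folner : ∀ (n : ℕ+), ∀ g ∈ K n,
    (((g • (A n : Set Γ)) ∆ (A n : Set Γ)).ncard : ℝ) / ((A n).card : ℝ) < (1 / 2 : ℝ) ^ (n : ℕ)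

/-! ## Spaces with measured walls -/

/-- The partition `W` of `X` (a set of subsets of `X`, of the form `{A, Aᶜ}`) separates `x`
and `y`. -/
def Separates {X : Type*} (W : Set (Set X)) (x y : X) : Prop := ∃ A ∈ W, x ∈ A ∧ y ∉ A

/-- The structure of a space with measured walls on a set `X`: a set of walls, that is, of
partitions `{A, Aᶜ}` of `X` into two classes, with a `σ`-algebra and a measure on the set of walls
such that the set of walls separating `x` and `y` is measurable and of finite measure.
(For `x = y` this set is empty.) -/
structure MeasuredWalls (X : Type u) where
  walls : Set (Set (Set X))
  isWall : ∀ W ∈ walls, ∃ A : Set X, W = {A, Aᶜ}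
  σ : MeasurableSpace walls
  μ : @Measure walls σ
  measurableSet_sep : ∀ x y : X, MeasurableSet[σ] {W : walls | Separates W.1 x y}
  sep_ne_top : ∀ x y : X, μ {W : walls | Separates W.1 x y} ≠ ∞

attribute [instance] MeasuredWalls.σ

namespace MeasuredWalls

/-- The set of walls separating `x` and `y`. -/
def sep {X : Type u} (M : MeasuredWalls X) (x y : X) : Set M.walls := {W | Separates W.1 x y}

/-- The wall distance: the measure of the set of walls separating `x` and `y`. -/
noncomputable def w {X : Type u} (M : MeasuredWalls X) (x y : X) : ℝ≥0∞ := M.μ (M.sep x y)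

theorem sep_triangle {X : Type u} (M : MeasuredWalls X) (x y z : X) :
    M.sep x z ⊆ M.sep x y ∪ M.sep y z := by
  rintro W ⟨A, hA, hx, hz⟩
  by_cases hy : y ∈ A
  · exact Or.inr ⟨A, hA, hy, hz⟩
  · exact Or.inl ⟨A, hA, hx, hy⟩

theorem w_triangle {X : Type u} (M : MeasuredWalls X) (x y z : X) :
    M.w x z ≤ M.w x y + M.w y z :=
  (measure_mono (M.sep_triangle x y z)).trans (measure_union_le _ _)

theorem sep_comm {X : Type u} (M : MeasuredWalls X) (x y : X) : M.sep x y = M.sep y x := by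
  have key : ∀ a b : X, M.sep a b ⊆ M.sep b a := by
    rintro a b ⟨W, hW⟩ ⟨B, hB, ha, hb⟩
    obtain ⟨A, rfl⟩ := M.isWall W hW
    refine ⟨Bᶜ, ?_, hb, fun h => h ha⟩
    rcases hB with rfl | rfl
    · exact Or.inr rfl
    · exact Or.inl (compl_compl A)
  exact (key x y).antisymm (key y x)

theorem w_comm {X : Type u} (M : MeasuredWalls X) (x y : X) : M.w x y = M.w y x := by
  simp only [w, M.sep_comm x y]

theorem w_self {X : Type u} (M : MeasuredWalls X) (x : X) : M.w x x = 0 := by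
  have h : M.sep x x = ∅ := by
    ext W
    simp only [sep, Separates, mem_ofPred_eq, mem_empty_iff_false, iff_false]
    rintro ⟨A, -, h1, h2⟩
    exact h2 h1
  simp [w, h]

/-- An invariant action: the group maps walls to walls, by `g • {B, Bᶜ} = {g • B, g • Bᶜ}`, and
acts on the set of walls by measurable, measure preserving maps. -/
structure IsInvariantAction (Γ : Type*) [Group Γ] {X : Type u} [MulAction Γ X]
    (M : MeasuredWalls X) : Prop where
  smul_mem : ∀ (g : Γ), ∀ W ∈ M.walls, g • W ∈ M.walls
  measurePreserving : ∀ g : Γ,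
    MeasurePreserving (fun W : M.walls => (⟨g • W.1, smul_mem g W.1 W.2⟩ : M.walls)) M.μ M.μ

/-- A proper action: the group preserves the family of walls and the wall distance, and for some
`x₀` the distance `w x₀ (g • x₀)` tends to infinity as `g` leaves every finite set. -/
structure IsProperAction (Γ : Type*) [Group Γ] {X : Type u} [MulAction Γ X]
    (M : MeasuredWalls X) : Prop where
  smul_mem : ∀ (g : Γ), ∀ W ∈ M.walls, g • W ∈ M.walls
  w_smul : ∀ (g : Γ) (x y : X), M.w (g • x) (g • y) = M.w x y
  proper : ∃ x₀ : X, Tendsto (fun g : Γ => M.w x₀ (g • x₀)) cofinite (𝓝 ∞)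

/-! ### Products of pointed spaces with measured walls -/

/-- The underlying set of the product of the pointed spaces `(X i, x₀ i)`: all points at finite
total wall distance from `x₀`. -/
@[ext]
structure ProdSpace {ι : Type*} {X : ι → Type u} (M : ∀ i, MeasuredWalls (X i))
    (x₀ : ∀ i, X i) where
  val : ∀ i, X i
  tsum_ne_top : ∑' i, (M i).w (x₀ i) (val i) ≠ ∞

/-- The pull-back of a wall of the `i`-th factor under the projection `x ↦ x i`. -/
def pullWall {ι : Type*} {X : ι → Type u} (M : ∀ i, MeasuredWalls (X i)) (x₀ : ∀ i, X i) (i : ι)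
    (W : Set (Set (X i))) : Set (Set (ProdSpace M x₀)) :=
  (fun A : Set (X i) => {x : ProdSpace M x₀ | x.val i ∈ A}) '' W

theorem separates_pullWall {ι : Type*} {X : ι → Type u} (M : ∀ i, MeasuredWalls (X i))
    (x₀ : ∀ i, X i) (i : ι) (W : Set (Set (X i))) (x y : ProdSpace M x₀) :
    Separates (pullWall M x₀ i W) x y ↔ Separates W (x.val i) (y.val i) := by
  simp [Separates, pullWall]

/-- The set of walls of the product: all pull-backs of walls of the factors. -/
def prodWalls {ι : Type*} {X : ι → Type u} (M : ∀ i, MeasuredWalls (X i)) (x₀ : ∀ i, X i) :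
    Set (Set (Set (ProdSpace M x₀))) :=
  {V | ∃ i, ∃ W ∈ (M i).walls, V = pullWall M x₀ i W}

/-- The map from the walls of the `i`-th factor to the walls of the product. -/
def liftWall {ι : Type*} {X : ι → Type u} (M : ∀ i, MeasuredWalls (X i)) (x₀ : ∀ i, X i) (i : ι)
    (W : (M i).walls) : prodWalls M x₀ :=
  ⟨pullWall M x₀ i W.1, i, W.1, W.2, rfl⟩

/-- The product of pointed spaces with measured walls. A set of walls is measurable if for each `i`
the walls coming from the `i`-th factor form a measurable set there, and the measure is the sum of
the measures of the factors. -/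
noncomputable def prod {ι : Type*} {X : ι → Type u} (M : ∀ i, MeasuredWalls (X i))
    (x₀ : ∀ i, X i) : MeasuredWalls (ProdSpace M x₀) where
  walls := prodWalls M x₀
  isWall := by
    rintro _ ⟨i, W, hW, rfl⟩
    obtain ⟨A, rfl⟩ := (M i).isWall W hW
    exact ⟨{x | x.val i ∈ A}, by simp only [pullWall, image_pair]; rfl⟩
  σ := ⨅ i, MeasurableSpace.map (liftWall M x₀ i) (M i).σ
  μ := @Measure.sum _ _ (⨅ i, MeasurableSpace.map (liftWall M x₀ i) (M i).σ) fun i =>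
    @Measure.map _ _ _ (⨅ i, MeasurableSpace.map (liftWall M x₀ i) (M i).σ)
      (liftWall M x₀ i) (M i).μ
  measurableSet_sep := by
    intro x y
    rw [MeasurableSpace.measurableSet_iInf]
    intro i
    have h := (M i).measurableSet_sep (x.val i) (y.val i)
    simpa only [MeasurableSpace.map_def, liftWall, preimage_ofPred_eq, separates_pullWall] using h
  sep_ne_top := by
    intro x y
    let _ : MeasurableSpace (prodWalls M x₀) :=
      ⨅ i, MeasurableSpace.map (liftWall M x₀ i) (M i).σ
    have hm : MeasurableSet {W : prodWalls M x₀ | Separates W.1 x y} := by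
      rw [MeasurableSpace.measurableSet_iInf]
      intro i
      have h := (M i).measurableSet_sep (x.val i) (y.val i)
      simpa only [MeasurableSpace.map_def, liftWall, preimage_ofPred_eq, separates_pullWall] using h
    have hl : ∀ i, Measurable (liftWall M x₀ i) := fun i s hs =>
      (MeasurableSpace.measurableSet_iInf.1 hs) i
    rw [Measure.sum_apply _ hm]
    have he : ∀ i, (Measure.map (liftWall M x₀ i) (M i).μ)
        {W : prodWalls M x₀ | Separates W.1 x y} = (M i).w (x.val i) (y.val i) := by
      intro i
      rw [Measure.map_apply (hl i) hm]
      simp only [liftWall, preimage_ofPred_eq, separates_pullWall]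
      rfl
    simp only [he]
    refine ne_top_of_le_ne_top (ENNReal.add_ne_top.2 ⟨x.tsum_ne_top, y.tsum_ne_top⟩) ?_
    rw [← ENNReal.tsum_add]
    refine ENNReal.tsum_le_tsum fun i => ?_
    rw [(M i).w_comm (x₀ i) (x.val i)]
    exact (M i).w_triangle _ _ _

/-! ### The walls given by the translates of a finite subset of a group -/

/-- The wall `{g A⁻¹, (g A⁻¹)ᶜ}` on the group. -/
def translateWall {Γ : Type u} [Group Γ] (A : Finset Γ) (g : Γ) : Set (Set Γ) :=
  {g • (A : Set Γ)⁻¹, (g • (A : Set Γ)⁻¹)ᶜ}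

theorem separates_translateWall {Γ : Type u} [Group Γ] (A : Finset Γ) (g x y : Γ) :
    Separates (translateWall A g) x y ↔ g ∈ (x • (A : Set Γ)) ∆ (y • (A : Set Γ)) := by
  have h : ∀ z : Γ, z ∈ g • (A : Set Γ)⁻¹ ↔ g ∈ z • (A : Set Γ) := by
    intro z
    simp [Set.mem_smul_set_iff_inv_smul_mem]
  simp only [Separates, translateWall, mem_insert_iff, mem_singleton_iff, exists_eq_or_imp,
    exists_eq_left, mem_compl_iff, not_not, h, Set.mem_symmDiff]
  tauto

/-- The measure of a set of walls `{g A⁻¹, (g A⁻¹)ᶜ}`: each `g ∈ Γ` contributes mass `c`. This is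
counting measure normalised by `c`, where walls are counted with their multiplicity as members of
the family indexed by `g ∈ Γ`. -/
noncomputable def translateMeasure {Γ : Type u} [Group Γ] (A : Finset Γ) (c : ℝ≥0) :
    @Measure (range (translateWall A)) ⊤ :=
  @Measure.sum _ Γ ⊤ fun g => c • @Measure.dirac _ ⊤ ⟨translateWall A g, g, rfl⟩

theorem translateMeasure_sep {Γ : Type u} [Group Γ] (A : Finset Γ) (c : ℝ≥0) (x y : Γ) :
    translateMeasure A c {W | Separates W.1 x y} =
      c * (((x • (A : Set Γ)) ∆ (y • (A : Set Γ))).encard : ℝ≥0∞) := by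
  let _ : MeasurableSpace (range (translateWall A)) := ⊤
  have htop : ∀ s : Set (range (translateWall A)), MeasurableSet s := fun _ => trivial
  rw [translateMeasure, Measure.sum_apply _ (htop _)]
  have : ∀ g : Γ, (c • Measure.dirac (⟨translateWall A g, g, rfl⟩ : range (translateWall A)))
      {W | Separates W.1 x y} =
      ((x • (A : Set Γ)) ∆ (y • (A : Set Γ))).indicator (fun _ => (c : ℝ≥0∞)) g := by
    intro g
    rw [Measure.smul_apply, Measure.dirac_apply' _ (htop _)]
    by_cases hg : g ∈ (x • (A : Set Γ)) ∆ (y • (A : Set Γ))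
    · have h : Separates (translateWall A g) x y := (separates_translateWall A g x y).2 hg
      simp [hg, h, ENNReal.smul_def]
    · have h : ¬ Separates (translateWall A g) x y :=
        fun h => hg ((separates_translateWall A g x y).1 h)
      simp [hg, h]
  simp only [this]
  rw [← tsum_subtype, ENNReal.tsum_const, mul_comm]
  rfl

theorem finite_symmDiff_smul {Γ : Type u} [Group Γ] (A : Finset Γ) (x y : Γ) :
    ((x • (A : Set Γ)) ∆ (y • (A : Set Γ))).Finite :=
  ((A.finite_toSet.smul_set).union (A.finite_toSet.smul_set)).subset symmDiff_subset_union

/-- The space with measured walls on `Γ` whose walls are `{g A⁻¹, (g A⁻¹)ᶜ}`, `g ∈ Γ`, with the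
power set as `σ`-algebra and with counting measure normalised by `c`. -/
noncomputable def translates {Γ : Type u} [Group Γ] (A : Finset Γ) (c : ℝ≥0) :
    MeasuredWalls Γ where
  walls := range (translateWall A)
  isWall := by
    rintro _ ⟨g, rfl⟩
    exact ⟨_, rfl⟩
  σ := ⊤
  μ := translateMeasure A c
  measurableSet_sep := fun _ _ => trivial
  sep_ne_top := by
    intro x y
    rw [translateMeasure_sep]
    refine ENNReal.mul_ne_top ENNReal.coe_ne_top ?_
    rw [← (finite_symmDiff_smul A x y).cast_ncard_eq]
    simp

theorem translates_w {Γ : Type u} [Group Γ] (A : Finset Γ) (c : ℝ≥0) (x y : Γ) :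
    (translates A c).w x y = c * (((x • (A : Set Γ)) ∆ (y • (A : Set Γ))).ncard : ℝ≥0∞) := by
  refine (translateMeasure_sep A c x y).trans ?_
  rw [← (finite_symmDiff_smul A x y).cast_ncard_eq]
  simp

theorem translates_w_mul {Γ : Type u} [Group Γ] (A : Finset Γ) (c : ℝ≥0) (g x y : Γ) :
    (translates A c).w (g * x) (g * y) = (translates A c).w x y := by
  rw [translates_w, translates_w, mul_smul, mul_smul, ← Set.smul_set_symmDiff,
    Set.ncard_smul_set]

end MeasuredWalls

/-! ## The space with measured walls of a Følner sequence -/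

namespace FolnerSequence

open MeasuredWalls

/-- The `n`-th factor: the translates of `(A n)⁻¹`, each of mass `n / |A n|`. -/
noncomputable def factor {Γ : Type u} [Group Γ] (F : FolnerSequence Γ) (n : ℕ+) :
    MeasuredWalls Γ :=
  translates (F.A n) ((n : ℝ≥0) / ((F.A n).card : ℝ≥0))

/-- The underlying set of the product of the factors, each pointed at the identity. -/
abbrev Space {Γ : Type u} [Group Γ] (F : FolnerSequence Γ) :=
  ProdSpace F.factor (fun _ => (1 : Γ))

/-- The product of the factors, each pointed at the identity. -/
noncomputable def measuredWalls {Γ : Type u} [Group Γ] (F : FolnerSequence Γ) :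
    MeasuredWalls F.Space :=
  MeasuredWalls.prod F.factor (fun _ => (1 : Γ))

theorem tsum_w_ne_top {Γ : Type u} [Group Γ] (F : FolnerSequence Γ) (g : Γ) :
    ∑' n, (F.factor n).w 1 g ≠ ∞ := by
  obtain ⟨N, hN⟩ := F.isExhaustion.exhausts g
  have hfin : ∀ n, (F.factor n).w 1 g ≠ ∞ := fun n => (F.factor n).sep_ne_top 1 g
  have hle : ∀ n : ℕ+, N ≤ n → ((F.factor n).w 1 g).toReal ≤ (n : ℕ) * (1 / 2 : ℝ) ^ (n : ℕ) := by
    intro n hn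
    have h := (F.folner n g (F.isExhaustion.mono hn hN)).le
    have e : ((F.factor n).w 1 g).toReal = (n : ℕ) *
        ((((g • (F.A n : Set Γ)) ∆ (F.A n : Set Γ)).ncard : ℝ) / ((F.A n).card : ℝ)) := by
      rw [factor, translates_w, one_smul, symmDiff_comm]
      simp only [ENNReal.toReal_mul, ENNReal.coe_toReal, NNReal.coe_div, NNReal.coe_natCast,
        ENNReal.toReal_natCast]
      ring
    rw [e]
    exact mul_le_mul_of_nonneg_left h (Nat.cast_nonneg _)
  have hs : Summable fun n : ℕ+ => (n : ℕ) * (1 / 2 : ℝ) ^ (n : ℕ) := by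
    have h := summable_pow_mul_geometric_of_norm_lt_one (R := ℝ) 1 (r := 1 / 2) (by norm_num)
    simp only [pow_one] at h
    exact h.comp_injective (i := fun n : ℕ+ => (n : ℕ)) PNat.coe_injective
  have hs' : Summable fun n : ℕ+ => ((F.factor n).w 1 g).toReal := by
    refine Summable.of_norm_bounded_eventually hs ?_
    refine (Finset.Iio N).finite_toSet.subset ?_
    intro n hn
    by_contra hlt
    refine hn ?_
    have h := hle n (by simpa using hlt)
    rw [← Real.norm_of_nonneg (ENNReal.toReal_nonneg (a := (F.factor n).w 1 g))] at h
    exact h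
  have h := hs'.tsum_ofReal_ne_top
  simpa only [ENNReal.ofReal_toReal (hfin _)] using h

/-- The diagonal action. -/
instance instMulAction {Γ : Type u} [Group Γ] (F : FolnerSequence Γ) : MulAction Γ F.Space where
  smul g x := ⟨fun n => g * x.val n, by
    refine ne_top_of_le_ne_top (ENNReal.add_ne_top.2 ⟨F.tsum_w_ne_top g, x.tsum_ne_top⟩) ?_
    rw [← ENNReal.tsum_add]
    refine ENNReal.tsum_le_tsum fun n => ?_
    refine ((F.factor n).w_triangle 1 g (g * x.val n)).trans (add_le_add le_rfl ?_)
    have h := translates_w_mul (F.A n) ((n : ℝ≥0) / ((F.A n).card : ℝ≥0)) g 1 (x.val n)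
    rw [mul_one] at h
    exact h.le⟩
  one_smul x := MeasuredWalls.ProdSpace.ext (funext fun n => one_mul (x.val n))
  mul_smul g h x := MeasuredWalls.ProdSpace.ext (funext fun n => mul_assoc g h (x.val n))

/-- The base point `(1, 1, …)`. -/
def basePoint {Γ : Type u} [Group Γ] (F : FolnerSequence Γ) : F.Space :=
  ⟨fun _ => 1, by simp [MeasuredWalls.w_self]⟩

end FolnerSequence

/-! ## Poisson processes -/

/-- `η`, defined on the probability space `(Ω, P)`, is a Poisson process on `E` with intensity
measure `lam`: a random element of the space of countable sums of finite `ℕ`-valued measures such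
that `η B` has the Poisson distribution with parameter `lam B` (so that `η B = ∞` almost surely if
`lam B = ∞`) and such that the values of `η` on disjoint sets are independent. -/
structure IsPoissonProcess {Ω : Type*} [MeasurableSpace Ω] (P : Measure Ω)
    {E : Type*} [MeasurableSpace E] (lam : Measure E) (η : Ω → Measure E) : Prop where
  isProbabilityMeasure : IsProbabilityMeasure P
  counting : ∀ ω, ∃ ν : ℕ → Measure E,
    (∀ i, IsFiniteMeasure (ν i) ∧ ∀ B, MeasurableSet B → ∃ k : ℕ, ν i B = k) ∧
    η ω = Measure.sum ν
  measurable : Measurable η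
  poisson : ∀ B, MeasurableSet B → lam B ≠ ∞ → ∀ k : ℕ, P {ω | η ω B = k} =
    ENNReal.ofReal (Real.exp (-(lam B).toReal) * (lam B).toReal ^ k / (k.factorial : ℝ))
  poisson_top : ∀ B, MeasurableSet B → lam B = ∞ → ∀ k : ℕ, P {ω | η ω B = k} = 0
  indep : ∀ (n : ℕ) (B : Fin n → Set E), (∀ i, MeasurableSet (B i)) →
    Pairwise (fun i j => Disjoint (B i) (B j)) → iIndepFun (fun i ω => η ω (B i)) P

/-! ## Bond percolation -/

/-- A bond percolation on the graph `G` on the group `Γ`, invariant under left multiplication: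
a probability measure on the sets of edges of `G` (with the product `σ`-algebra) which is
invariant under the left action of `Γ` on edges. -/
structure IsInvariantBondPercolation {Γ : Type*} [Group Γ] (G : SimpleGraph Γ)
    (Q : Measure (Set (Sym2 Γ))) : Prop where
  isProbabilityMeasure : IsProbabilityMeasure Q
  subset_edgeSet : ∀ᵐ ω ∂Q, ω ⊆ G.edgeSet
  invariant : ∀ g : Γ, Q.map (fun ω => Sym2.map (fun x => g * x) '' ω) = Q

/-- The bond configuration associated with a measure `η` on the set of walls of a space on which
`Γ` acts, and with a point `x₀`: the edge `[g, h]` of `G` is kept if and only if `η` gives no mass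
to the walls separating `g • x₀` and `h • x₀`. -/
def wallPercolation {Γ : Type*} [Group Γ] (G : SimpleGraph Γ) {X : Type u} [MulAction Γ X]
    (M : MeasuredWalls X) (x₀ : X) (η : Measure M.walls) : Set (Sym2 Γ) :=
  {e | e ∈ G.edgeSet ∧ ∀ g h : Γ, e = s(g, h) → η (M.sep (g • x₀) (h • x₀)) = 0}

/-- No cluster of the bond configuration `ω` is infinite; clusters are the connected components of
the graph with all vertices and with edge set `ω`. -/
def NoInfiniteCluster {V : Type*} (ω : Set (Sym2 V)) : Prop :=
  ∀ C : (SimpleGraph.fromEdgeSet ω).ConnectedComponent, C.supp.Finite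

/-- The number of neighbours of the vertex `v` in `G`. -/
noncomputable def vertexDegree {V : Type*} (G : SimpleGraph V) (v : V) : ℕ :=
  (G.neighborSet v).ncard

/-! ## Amenable groups have Følner sets -/

section Folner

/-! The wall with index `g` in the `n`-th factor has the finite half `g A_n⁻¹`, and a point `v` lies
in it exactly when `g ∈ v A_n`. Two estimates pull against each other. The walls of the `n`-th
factor with `v` in this half have mass at least `n`, however large `n` is. Yet the distance from `o`
to `g` is the sum of `n |g A_n ∆ A_n| / |A_n|`, whose terms are eventually below `n 2⁻ⁿ`, so it is
finite.

The first estimate gives properness, since `A_n` and `g A_n` are disjoint for all but finitely many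
`g`, and it kills infinite clusters: the Poisson process misses all walls around `v` with
probability at most `exp (-(1 - p) n)` for every `n`, hence almost never. An open edge cannot cross
a hit wall, so the cluster of `v` stays in a finite half (`noInfiniteCluster_of_wallsAround`,
`ae_noInfiniteCluster`).

The second estimate makes the expected degree `∑ exp (-(1 - p) w(o, s))`, summed over the neighbours
`s` of `o`, tend to the full degree as `p → 1` (`integral_vertexDegree`, `exists_lt_sum_exp`).
Invariance holds because the law of the percolation is determined by void probabilities, which
depend only on the invariant measure `μ`.

Følner sets come from the invariant mean: Hahn–Banach yields almost invariant probability vectors in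
`ℓ¹` (`zero_mem_closure`), and slicing one into level sets yields an almost invariant set
(`mul_tsum_le_of_forall_finset`). The Poisson process is built from independent Poisson
multiplicities on the countable set of walls. -/

theorem tsum_indicator_const_of_finite {α : Type*} {s : Set α} (hs : s.Finite) (c : ℝ) :
    ∑' x, s.indicator (fun _ => c) x = c * s.ncard := by
  rw [tsum_eq_sum (s := hs.toFinset) (fun x hx =>
      Set.indicator_of_notMem (by simpa using hx) _),
    Finset.sum_congr rfl (g := fun _ => c) (fun x hx => by
      rw [Set.indicator_of_mem (by simpa using hx)]), Finset.sum_const,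
    ← Set.ncard_eq_toFinset_card s hs, nsmul_eq_mul, mul_comm]

theorem summable_abs_translate_sub {Γ : Type*} [Group Γ] {f : Γ → ℝ} (hf : f.support.Finite)
    (g : Γ) : Summable fun x => |f (g⁻¹ * x) - f x| := by
  refine summable_of_hasFiniteSupport ((hf.union (hf.image (g * ·))).subset fun x hx => ?_)
  by_contra h
  simp only [mem_union, Function.mem_support, mem_image, not_or, not_not, not_exists, not_and] at h
  refine hx ?_
  have : f (g⁻¹ * x) = 0 := by
    by_contra h0
    exact h.2 _ h0 (by group)
  simp [h.1, this]

/-- If all finite sets have large boundary then so do all finitely supported functions, by the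
decomposition of a function into the indicators of its level sets. -/
theorem mul_tsum_le_of_forall_finset {Γ : Type*} [Group Γ] (K : Finset Γ) (ε : ℝ)
    (h : ∀ A : Finset Γ, A.Nonempty →
      ε * A.card ≤ ∑ g ∈ K, (((g • (A : Set Γ)) ∆ (A : Set Γ)).ncard : ℝ))
    (n : ℕ) : ∀ f : Γ → ℝ, (∀ x, 0 ≤ f x) → f.support.Finite → f.support.ncard = n →
      ε * ∑' x, f x ≤ ∑ g ∈ K, ∑' x, |f (g⁻¹ * x) - f x| := by
  induction n using Nat.strong_induction_on with
  | _ n ih =>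
    intro f hf0 hfin hn
    rcases f.support.eq_empty_or_nonempty with he | hne
    · have : f = 0 := Function.support_eq_empty_iff.1 he
      simp [this]
    set A : Finset Γ := hfin.toFinset with hA
    have hmem : ∀ x, x ∈ A ↔ f x ≠ 0 := fun x => by simp [A]
    have hAne : A.Nonempty := by simpa [A] using hne
    obtain ⟨x₀, hx₀, hmin⟩ := A.exists_min_image f hAne
    set m := f x₀ with hm
    have hm0 : 0 < m := lt_of_le_of_ne (hf0 _) (Ne.symm ((hmem _).1 hx₀))
    -- Removing the lowest layer, of height `m` over the whole support, keeps the function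
    -- non-negative and drops `x₀` from the support, so the induction applies.
    set f' : Γ → ℝ := fun x => f x - (A : Set Γ).indicator (fun _ => m) x with hf'
    have hin : ∀ x ∈ A, f' x = f x - m := fun x hx => by
      simp only [hf']; rw [Set.indicator_of_mem (by exact_mod_cast hx)]
    have hout : ∀ x ∉ A, f x = 0 ∧ f' x = 0 := fun x hx => by
      have h0 : f x = 0 := by by_contra h; exact hx ((hmem x).2 h)
      simp only [hf']; rw [Set.indicator_of_notMem (by exact_mod_cast hx)]; simp [h0]
    have hf'0 : ∀ x, 0 ≤ f' x := fun x => by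
      by_cases hx : x ∈ A
      · rw [hin x hx]; exact sub_nonneg.2 (hmin x hx)
      · rw [(hout x hx).2]
    have hsub : f'.support ⊂ f.support := by
      refine ⟨fun x hx => ?_, fun hh => ?_⟩
      · by_contra h0
        exact hx (hout x (by rw [hmem]; exact h0)).2
      · have := hh ((hmem x₀).1 hx₀)
        exact this (by rw [hin x₀ hx₀]; simp [hm])
    have hfin' : f'.support.Finite := hfin.subset hsub.1
    have hih := ih _ (hn ▸ Set.ncard_lt_ncard hsub hfin) f' hf'0 hfin' rfl
    have hsum : ∑' x, f x = m * A.card + ∑' x, f' x := by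
      have e : ∀ x, f x = (A : Set Γ).indicator (fun _ => m) x + f' x := fun x => by simp [hf']
      rw [tsum_congr e, Summable.tsum_add
        (summable_of_hasFiniteSupport (A.finite_toSet.subset Set.support_indicator_subset))
        (summable_of_hasFiniteSupport hfin'),
        tsum_indicator_const_of_finite A.finite_toSet, Set.ncard_coe_finset]
    -- The absolute values add without loss: where exactly one of `g⁻¹ * x` and `x` lies in `A`, the
    -- layer and the remainder change in the same direction; elsewhere the layer contributes
    -- nothing.
    have hdiff : ∀ g : Γ, ∑' x, |f (g⁻¹ * x) - f x| =
        m * ((g • (A : Set Γ)) ∆ (A : Set Γ)).ncard + ∑' x, |f' (g⁻¹ * x) - f' x| := by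
      intro g
      have hs := MeasuredWalls.finite_symmDiff_smul A g 1
      rw [one_smul] at hs
      have e : ∀ x, |f (g⁻¹ * x) - f x| =
          ((g • (A : Set Γ)) ∆ (A : Set Γ)).indicator (fun _ => m) x +
            |f' (g⁻¹ * x) - f' x| := by
        intro x
        have hgx : x ∈ g • (A : Set Γ) ↔ g⁻¹ * x ∈ A := by
          rw [Set.mem_smul_set_iff_inv_smul_mem, smul_eq_mul, Finset.mem_coe]
        by_cases h1 : g⁻¹ * x ∈ A <;> by_cases h2 : x ∈ A
        · rw [Set.indicator_of_notMem (by simp [Set.mem_symmDiff, hgx, h1, h2]), hin _ h1, hin _ h2]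
          simp
        · rw [Set.indicator_of_mem (by simp [Set.mem_symmDiff, hgx, h1, h2]), (hout _ h2).1,
            (hout _ h2).2, sub_zero, sub_zero, abs_of_nonneg (hf0 _), abs_of_nonneg (hf'0 _),
            hin _ h1]
          ring
        · rw [Set.indicator_of_mem (by simp [Set.mem_symmDiff, hgx, h1, h2]), (hout _ h1).1,
            (hout _ h1).2, zero_sub, zero_sub, abs_neg, abs_neg, abs_of_nonneg (hf0 _),
            abs_of_nonneg (hf'0 _), hin _ h2]
          ring
        · rw [Set.indicator_of_notMem (by simp [Set.mem_symmDiff, hgx, h1, h2]), (hout _ h1).1,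
            (hout _ h1).2, (hout _ h2).1, (hout _ h2).2]
          simp
      rw [tsum_congr e, Summable.tsum_add
        (summable_of_hasFiniteSupport (hs.subset Set.support_indicator_subset))
        (summable_abs_translate_sub hfin' g), tsum_indicator_const_of_finite hs]
    rw [hsum, Finset.sum_congr rfl fun g _ => hdiff g, Finset.sum_add_distrib, ← Finset.mul_sum]
    have := mul_le_mul_of_nonneg_left (h A hAne) hm0.le
    linarith

/-- The point masses, as elements of `ℓ¹`. -/
noncomputable def pointMass {Γ : Type*} [DecidableEq Γ] (x : Γ) : lp (fun _ : Γ => ℝ) 1 :=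
  lp.single 1 x (1 : ℝ)

theorem lp_one_norm_eq {Γ : Type*} (f : lp (fun _ : Γ => ℝ) 1) : ‖f‖ = ∑' x, |f x| := by
  rw [lp.norm_eq_tsum_rpow (by simp)]
  simp

/-- The mean of a finite sum of bounded functions. -/
theorem mean_sum {Γ ι : Type*} {m : (Γ → ℝ) → ℝ}
    (hadd : ∀ f₁ f₂ : Γ → ℝ, (∃ C, ∀ x, |f₁ x| ≤ C) → (∃ C, ∀ x, |f₂ x| ≤ C) →
      m (fun x => f₁ x + f₂ x) = m f₁ + m f₂) (h0 : m (fun _ => 0) = 0)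
    (s : Finset ι) (F : ι → Γ → ℝ) (hF : ∀ i, ∃ C, ∀ x, |F i x| ≤ C) :
    m (fun x => ∑ i ∈ s, F i x) = ∑ i ∈ s, m (F i) := by
  classical
  induction s using Finset.induction_on with
  | empty => simpa using h0
  | insert i s hi ih =>
    simp only [Finset.sum_insert hi]
    rw [hadd _ _ (hF i), ih]
    choose C hC using hF
    exact ⟨∑ i ∈ s, C i, fun x => (Finset.abs_sum_le_sum_abs _ _).trans
      (Finset.sum_le_sum fun i _ => hC i x)⟩

/-- In an amenable group `0` is in the norm closure of the convex hull of the differences of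
translated point masses. -/
theorem IsAmenable.zero_mem_closure {Γ : Type*} [Group Γ] [DecidableEq Γ] (hΓ : IsAmenable Γ)
    (K : Finset Γ) :
    (0 : K → lp (fun _ : Γ => ℝ) 1) ∈ closure (convexHull ℝ
      (range fun (x : Γ) (g : K) => pointMass ((g : Γ) * x) - pointMass x)) := by
  obtain ⟨m, hadd, hsmul, hpos, hone, hinv⟩ := hΓ
  by_contra hcon
  -- The functional satisfies `φ > c > 0` on the hull. Its coordinates on point masses are bounded
  -- functions on `Γ`, to which the mean applies.
  obtain ⟨φ, c, hc0, hc⟩ := geometric_hahn_banach_point_closed (convex_convexHull ℝ _).closure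
    isClosed_closure hcon
  rw [map_zero] at hc0
  let ψ : K → Γ → ℝ := fun g x => φ (Pi.single g (pointMass x))
  have hψ : ∀ g, ∃ C, ∀ x, |ψ g x| ≤ C := fun g => ⟨‖φ‖, fun x => by
    refine (φ.le_opNorm _).trans ?_
    rw [Pi.norm_single, pointMass, lp.norm_single (by simp)]
    simp⟩
  have hψ' : ∀ g : K, ∃ C, ∀ x, |ψ g ((g : Γ) * x)| ≤ C := fun g =>
    (hψ g).imp fun C hC x => hC _
  have hval : ∀ x, c < ∑ g : K, (ψ g ((g : Γ) * x) + (-1) * ψ g x) := by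
    intro x
    refine (hc _ (subset_closure (subset_convexHull ℝ _ (mem_range_self x)))).trans_eq ?_
    rw [← Finset.univ_sum_single
      (fun (g : K) => (pointMass ((g : Γ) * x) - pointMass x : lp (fun _ : Γ => ℝ) 1)), map_sum]
    refine Finset.sum_congr rfl fun g _ => ?_
    rw [Pi.single_sub, map_sub]
    simp only [ψ]
    ring
  have h0 : m (fun _ => 0) = 0 := by
    have := hsmul 0 (fun _ => 0) ⟨0, by simp⟩
    simpa using this
  have hneg : ∀ g, ∃ C, ∀ x, |(-1) * ψ g x| ≤ C := fun g => (hψ g).imp fun C hC x => by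
    simpa using hC x
  have hb : ∀ g : K, ∃ C, ∀ x, |ψ g ((g : Γ) * x) + (-1) * ψ g x| ≤ C := fun g => by
    obtain ⟨C, hC⟩ := hψ' g
    obtain ⟨D, hD⟩ := hneg g
    exact ⟨C + D, fun x => (abs_add_le _ _).trans (add_le_add (hC x) (hD x))⟩
  have hm0 : m (fun x => ∑ g : K, (ψ g ((g : Γ) * x) + (-1) * ψ g x)) = 0 := by
    rw [mean_sum hadd h0 Finset.univ _ hb]
    refine Finset.sum_eq_zero fun g _ => ?_
    rw [hadd _ _ (hψ' g) (hneg g), hsmul _ _ (hψ g)]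
    have := hinv (g : Γ)⁻¹ (ψ g) (hψ g)
    rw [inv_inv] at this
    rw [this]
    ring
  have hbs : ∃ C, ∀ x, |∑ g : K, (ψ g ((g : Γ) * x) + (-1) * ψ g x)| ≤ C := by
    choose C hC using hb
    exact ⟨∑ g, C g, fun x => (Finset.abs_sum_le_sum_abs _ _).trans
      (Finset.sum_le_sum fun i _ => hC i x)⟩
  have hcb : ∃ C, ∀ _ : Γ, |(-c) * 1| ≤ C := ⟨|(-c) * 1|, fun _ => le_rfl⟩
  -- The sum of translates minus originals exceeds `c` everywhere but has mean `0`; positivity of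
  -- the mean then gives `-c ≥ 0`.
  have hfin := hpos (fun x => ∑ g : K, (ψ g ((g : Γ) * x) + (-1) * ψ g x) + (-c) * 1) (by
    obtain ⟨C, hC⟩ := hbs
    obtain ⟨D, hD⟩ := hcb
    exact ⟨C + D, fun x => (abs_add_le _ _).trans (add_le_add (hC x) (hD x))⟩) (fun x => by
      have := hval x
      linarith)
  rw [hadd _ _ hbs hcb, hm0, hsmul (-c) (fun _ => 1) ⟨1, by simp⟩, hone] at hfin
  linarith

/-- Day's theorem, with Namioka's proof: an amenable group has Følner sets. -/
theorem IsAmenable.exists_folner_set {Γ : Type*} [Group Γ] (hΓ : IsAmenable Γ) (K : Finset Γ)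
    {ε : ℝ} (hε : 0 < ε) :
    ∃ A : Finset Γ, A.Nonempty ∧
      ∀ g ∈ K, (((g • (A : Set Γ)) ∆ (A : Set Γ)).ncard : ℝ) / (A.card : ℝ) < ε := by
  classical
  by_contra hcon
  push Not at hcon
  have hK : 0 < (K.card : ℝ) + 1 := by positivity
  -- With this tolerance the `|K|` displacements of `f` add up to at most `|K| ε / (|K| + 1) < ε`,
  -- whereas the failure of the Følner condition makes their sum at least `ε`.
  obtain ⟨b, hb, hdist⟩ := Metric.mem_closure_iff.1 (hΓ.zero_mem_closure K)
    (ε / (K.card + 1)) (by positivity)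
  obtain ⟨ι, _, w, z, hw0, hw1, hz, rfl⟩ := mem_convexHull_iff_exists_fintype.1 hb
  choose y hy using hz
  rw [dist_zero_left] at hdist
  let f : Γ → ℝ := fun x => ∑ i, w i * Pi.single (M := fun _ : Γ => ℝ) (y i) (1 : ℝ) x
  have hf0 : ∀ x, 0 ≤ f x := fun x => Finset.sum_nonneg fun i _ =>
    mul_nonneg (hw0 i) (by rw [Pi.single_apply]; split_ifs <;> norm_num)
  have hfin : f.support.Finite := by
    refine (Set.finite_range y).subset fun x hx => ?_
    by_contra h
    refine hx (Finset.sum_eq_zero fun i _ => ?_)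
    rw [Pi.single_eq_of_ne (fun h' => h ⟨i, h'.symm⟩), mul_zero]
  have hfsum : ∑' x, f x = 1 := by
    simp only [f]
    rw [Summable.tsum_finsetSum fun i _ => (hasSum_pi_single (y i) (1 : ℝ)).summable.mul_left _]
    simp_rw [tsum_mul_left, (hasSum_pi_single (y _) (1 : ℝ)).tsum_eq, mul_one, hw1]
  have key := mul_tsum_le_of_forall_finset K ε (fun A hA => by
    obtain ⟨g, hg, hle⟩ := hcon A hA
    rw [le_div_iff₀ (by exact_mod_cast hA.card_pos)] at hle
    exact hle.trans (Finset.single_le_sum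
      (f := fun g => (((g • (A : Set Γ)) ∆ (A : Set Γ)).ncard : ℝ))
      (fun _ _ => Nat.cast_nonneg _) hg)) _ f hf0 hfin rfl
  rw [hfsum, mul_one] at key
  have hterm : ∀ g ∈ K, ∑' x, |f (g⁻¹ * x) - f x| ≤ ε / (K.card + 1) := by
    intro g hg
    refine le_trans ?_ ((norm_le_pi_norm _ (⟨g, hg⟩ : K)).trans hdist.le)
    rw [lp_one_norm_eq]
    refine le_of_eq (tsum_congr fun x => ?_)
    congr 1
    rw [Finset.sum_apply, lp.coeFn_sum, Finset.sum_apply]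
    simp only [f]
    rw [← Finset.sum_sub_distrib]
    refine Finset.sum_congr rfl fun i _ => ?_
    rw [← hy i]
    simp only [Pi.smul_apply, lp.coeFn_smul, lp.coeFn_sub, Pi.sub_apply, pointMass,
      lp.single_apply, smul_eq_mul, Pi.single_apply]
    simp only [inv_mul_eq_iff_eq_mul, mul_sub]
  have := key.trans (Finset.sum_le_sum hterm)
  rw [Finset.sum_const, nsmul_eq_mul, mul_div_assoc', le_div_iff₀ hK] at this
  linarith

/-! ### Exhaustions, Følner sequences and countability -/

theorem exists_isExhaustion (Γ : Type*) [Nonempty Γ] [Countable Γ] :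
    ∃ K : ℕ+ → Finset Γ, IsExhaustion K := by
  classical
  obtain ⟨f, hf⟩ := exists_surjective_nat Γ
  refine ⟨fun n => (Finset.range n).image f, fun n => ?_, fun a b hab => ?_, fun g => ?_⟩
  · simp
  · exact Finset.image_subset_image (Finset.range_subset_range.2 hab)
  · obtain ⟨n, rfl⟩ := hf g
    exact ⟨n.succPNat, Finset.mem_image_of_mem f (by simp)⟩

theorem IsAmenable.exists_folnerSequence {Γ : Type*} [Group Γ] (hΓ : IsAmenable Γ)
    (K : ℕ+ → Finset Γ) (hK : IsExhaustion K) : ∃ F : FolnerSequence Γ, F.K = K := by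
  choose A hA hlt using fun n : ℕ+ =>
    hΓ.exists_folner_set (K n) (ε := (1 / 2 : ℝ) ^ (n : ℕ)) (by positivity)
  exact ⟨⟨K, hK, A, hA, hlt⟩, rfl⟩

theorem countable_of_closure_finset_eq_top {Γ : Type*} [Group Γ] (S : Finset Γ)
    (hS : Subgroup.closure (S : Set Γ) = ⊤) : Countable Γ := by
  have hc : Countable (FreeGroup S) :=
    Function.Surjective.countable (f := (FreeGroup.mk : List (S × Bool) → FreeGroup S))
      Quot.mk_surjective
  refine Function.Surjective.countable (f := FreeGroup.lift (fun s : S => (s : Γ))) ?_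
  rw [← MonoidHom.range_eq_top, FreeGroup.range_lift_eq_closure, Subtype.range_coe_subtype]
  exact hS

end Folner

/-! ## Poisson processes on countable spaces -/

section Poisson

/-- Grouping of independent `σ`-algebras along disjoint sets of indices. -/
theorem iIndep_biSup_of_pairwise_disjoint {Ω ι κ : Type*} {m : ι → MeasurableSpace Ω}
    {m0 : MeasurableSpace Ω} {P : Measure Ω} (hle : ∀ i, m i ≤ m0) (hm : iIndep m P)
    {S : κ → Set ι} (hS : Pairwise fun a b => Disjoint (S a) (S b)) :
    iIndep (fun a => ⨆ i ∈ S a, m i) P := by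
  classical
  have hP := hm.isProbabilityMeasure
  rw [iIndep_iff]
  intro s f
  induction s using Finset.induction_on with
  | empty => intro; simp
  | insert a s ha ih =>
    intro hf
    rw [Finset.set_biInter_insert, Finset.prod_insert ha,
      ← ih fun i hi => hf i (Finset.mem_insert_of_mem hi)]
    have hdisj : Disjoint (S a) (⋃ b ∈ s, S b) := by
      simp only [disjoint_iUnion_right]
      exact fun b hb => hS fun h => ha (h ▸ hb)
    refine (Indep_iff _ _ _).1 (indep_iSup_of_disjoint hle hm hdisj) _ _
      (hf a (Finset.mem_insert_self a s)) ?_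
    refine Finset.measurableSet_biInter s fun b hb => ?_
    exact (biSup_mono fun i hi => mem_biUnion hb hi :
      (⨆ i ∈ S b, m i) ≤ ⨆ i ∈ ⋃ b ∈ s, S b, m i) _ (hf b (Finset.mem_insert_of_mem hb))

/-- The sum of the members of a finite subfamily of independent Poisson variables is Poisson. -/
theorem hasLaw_finset_sum_poissonMeasure {Ω ι : Type*} {mΩ : MeasurableSpace Ω} {P : Measure Ω}
    {N : ι → Ω → ℕ} {r : ι → ℝ≥0} (hN : iIndepFun N P) (hm : ∀ i, Measurable (N i))
    (hr : ∀ i, HasLaw (N i) (poissonMeasure (r i)) P) (s : Finset ι) :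
    HasLaw (∑ i ∈ s, N i) (poissonMeasure (∑ i ∈ s, r i)) P := by
  classical
  have hP := hN.isProbabilityMeasure
  induction s using Finset.induction_on with
  | empty =>
    refine ⟨by rw [Finset.sum_empty]; exact aemeasurable_const, ?_⟩
    rw [Finset.sum_empty, Finset.sum_empty]
    refine Measure.ext_of_singleton fun n => ?_
    rw [Pi.zero_def, Measure.map_const, poissonMeasure_singleton]
    rcases Nat.eq_zero_or_pos n with rfl | h
    · simp
    · simp [h.ne', h.ne]
  | insert i s hi ih =>
    rw [Finset.sum_insert hi, Finset.sum_insert hi, add_comm, add_comm (r i)]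
    exact (hN.indepFun_finsetSum_of_notMem hm hi).hasLaw_add_poissonMeasure ih (hr i)

/-- Partial sums are integers, so convergence to `k` forces eventual equality with `k`. This gives
pointwise convergence of indicators when passing from finite to countable sums of Poisson variables.
-/
theorem ENNReal.eventually_natCast_eq_iff_of_hasSum {ι : Type*} {f : ι → ℕ} {a : ℝ≥0∞}
    (h : HasSum (fun i => (f i : ℝ≥0∞)) a) (k : ℕ) :
    ∀ᶠ s : Finset ι in atTop, (∑ i ∈ s, f i = k ↔ a = k) := by
  by_cases hk : a = k
  · have hle : ∀ s : Finset ι, ∑ i ∈ s, f i ≤ k := fun s => by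
      have := ENNReal.sum_le_tsum (f := fun i => (f i : ℝ≥0∞)) s
      rw [h.tsum_eq, hk] at this
      exact_mod_cast this
    -- Zero is separate because `k - 1` is truncated subtraction.
    rcases Nat.eq_zero_or_pos k with rfl | hpos
    · exact Eventually.of_forall fun s => by simpa [hk] using hle s
    · have hlt : ((k - 1 : ℕ) : ℝ≥0∞) < a := by
        rw [hk]; exact_mod_cast Nat.sub_lt hpos one_pos
      filter_upwards [h.eventually (lt_mem_nhds hlt)] with s hs
      have h1 : k - 1 < ∑ i ∈ s, f i := by exact_mod_cast hs
      have := hle s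
      simp only [hk, iff_true]
      omega
  · filter_upwards [h.eventually (isOpen_ne.mem_nhds hk)] with s hs
    simp only [hk, iff_false]
    exact fun h' => hs (by rw [← h']; push_cast; rfl)

theorem tendsto_poisson_weight_atTop (k : ℕ) :
    Tendsto (fun x : ℝ => Real.exp (-x) * x ^ k / (k.factorial : ℝ)) atTop (𝓝 0) := by
  have h := (Real.tendsto_pow_mul_exp_neg_atTop_nhds_zero k).div_const (k.factorial : ℝ)
  rw [zero_div] at h
  exact h.congr fun x => by ring

theorem measurable_tsum_natCast {Ω ι : Type*} [Countable ι] {mΩ : MeasurableSpace Ω}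
    {N : ι → Ω → ℕ} (hN : ∀ i, Measurable (N i)) : Measurable fun ω => ∑' i, (N i ω : ℝ≥0∞) :=
  Measurable.tsum fun i => measurable_from_top.comp (hN i)

/-- The distribution of the sum of a countable family of independent Poisson variables. -/
theorem measure_tsum_eq_of_poisson {Ω ι : Type*} [Countable ι] {mΩ : MeasurableSpace Ω}
    {P : Measure Ω} {N : ι → Ω → ℕ} {r : ι → ℝ≥0} (hN : iIndepFun N P)
    (hm : ∀ i, Measurable (N i)) (hr : ∀ i, HasLaw (N i) (poissonMeasure (r i)) P) (k : ℕ) :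
    P {ω | ∑' i, (N i ω : ℝ≥0∞) = k} = if ∑' i, (r i : ℝ≥0∞) = ∞ then 0 else
      ENNReal.ofReal (Real.exp (-(∑' i, (r i : ℝ≥0∞)).toReal) *
        (∑' i, (r i : ℝ≥0∞)).toReal ^ k / (k.factorial : ℝ)) := by
  have hP := hN.isProbabilityMeasure
  have hms : ∀ s : Finset ι, Measurable fun ω => ∑ i ∈ s, N i ω := fun s =>
    Finset.measurable_sum s fun i _ => hm i
  have hmt : Measurable fun ω => ∑' i, (N i ω : ℝ≥0∞) :=
    measurable_tsum_natCast hm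
  have hlim : Tendsto (fun s : Finset ι => P {ω | ∑ i ∈ s, N i ω = k}) atTop
      (𝓝 (P {ω | ∑' i, (N i ω : ℝ≥0∞) = k})) := by
    refine tendsto_measure_of_ae_tendsto_indicator_of_isFiniteMeasure atTop
      (hmt (measurableSet_singleton _)) (fun s => hms s (measurableSet_singleton _))
      (Eventually.of_forall fun ω => ?_)
    exact ENNReal.eventually_natCast_eq_iff_of_hasSum (ENNReal.summable.hasSum) k
  have hval : ∀ s : Finset ι, P {ω | ∑ i ∈ s, N i ω = k} =
      ENNReal.ofReal (Real.exp (-(∑ i ∈ s, (r i : ℝ))) *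
        (∑ i ∈ s, (r i : ℝ)) ^ k / (k.factorial : ℝ)) := by
    intro s
    have h := hasLaw_finset_sum_poissonMeasure hN hm hr s
    have e : {ω | ∑ i ∈ s, N i ω = k} = (∑ i ∈ s, N i) ⁻¹' {k} := by
      ext ω; simp
    rw [e, ← Measure.map_apply_of_aemeasurable h.aemeasurable (measurableSet_singleton _),
      h.map_eq, poissonMeasure_singleton, NNReal.coe_sum]
  refine tendsto_nhds_unique hlim ?_
  simp only [hval]
  -- An infinite total rate sends every Poisson weight to `0`; a finite one is handled by continuity
  -- of the weight in the rate.
  split_ifs with htop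
  · rw [← ENNReal.ofReal_zero]
    refine (ENNReal.continuous_ofReal.tendsto _).comp ((tendsto_poisson_weight_atTop k).comp ?_)
    have h1 : Tendsto (fun s : Finset ι => ((∑ i ∈ s, r i : ℝ≥0) : ℝ≥0∞)) atTop (𝓝 ∞) := by
      rw [← htop]
      simpa [HasSum] using (ENNReal.summable (f := fun i => (r i : ℝ≥0∞))).hasSum
    rw [ENNReal.tendsto_coe_nhds_top] at h1
    simpa using NNReal.tendsto_coe_atTop.2 h1
  · have hs : Summable r := ENNReal.tsum_coe_ne_top_iff_summable.1 htop
    have h1 : HasSum (fun i => (r i : ℝ)) (∑' i, (r i : ℝ≥0∞)).toReal := by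
      rw [← ENNReal.coe_tsum hs, ENNReal.coe_toReal]
      exact NNReal.hasSum_coe.2 hs.hasSum
    have hcont : Continuous fun x : ℝ => ENNReal.ofReal (Real.exp (-x) * x ^ k /
        (k.factorial : ℝ)) :=
      ENNReal.continuous_ofReal.comp (by fun_prop)
    exact (hcont.tendsto _).comp h1

/-- A Poisson process exists for every intensity measure with finite point masses on a countable
space. -/
theorem exists_poisson {E : Type u} [MeasurableSpace E] [Countable E]
    [MeasurableSingletonClass E] (lam : Measure E) (hlam : ∀ x, lam {x} ≠ ∞) :
    ∃ (Ω : Type u) (_ : MeasurableSpace Ω) (P : Measure Ω) (η : Ω → Measure E),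
      IsPoissonProcess P lam η := by
  classical
  let r : E → ℝ≥0 := fun x => (lam {x}).toNNReal
  let P : Measure (E → ℕ) := Measure.infinitePi fun x => poissonMeasure (r x)
  let η : (E → ℕ) → Measure E := fun ω => Measure.sum fun x => (ω x : ℝ≥0∞) • Measure.dirac x
  have hind : iIndepFun (fun (x : E) (ω : E → ℕ) => ω x) P :=
    iIndepFun_infinitePi (X := fun _ n => n) (by fun_prop)
  have hlaw : ∀ x, HasLaw (fun ω : E → ℕ => ω x) (poissonMeasure (r x)) P := fun x =>
    ⟨(measurable_pi_apply x).aemeasurable, Measure.infinitePi_map_eval _ x⟩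
  have hms : ∀ B : Set E, MeasurableSet B := fun B => B.to_countable.measurableSet
  have happ : ∀ ω B, η ω B = ∑' x : B, (ω x : ℝ≥0∞) := by
    intro ω B
    rw [Measure.sum_apply _ (hms B), tsum_subtype B fun x => (ω x : ℝ≥0∞)]
    refine tsum_congr fun x => ?_
    by_cases hx : x ∈ B <;> simp [hx, Measure.dirac_apply' _ (hms B)]
  have hlamB : ∀ B : Set E, ∑' x : B, (r x : ℝ≥0∞) = lam B := by
    intro B
    rw [← Measure.tsum_indicator_apply_singleton lam B (hms B),
      tsum_subtype B fun x => (r x : ℝ≥0∞)]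
    refine tsum_congr fun x => ?_
    by_cases hx : x ∈ B <;> simp [hx, r, hlam x]
  have hdist : ∀ (B : Set E) (k : ℕ), P {ω | η ω B = k} = if lam B = ∞ then 0 else
      ENNReal.ofReal (Real.exp (-(lam B).toReal) * (lam B).toReal ^ k / (k.factorial : ℝ)) := by
    intro B k
    have h := measure_tsum_eq_of_poisson (N := fun (x : B) (ω : E → ℕ) => ω x)
      (r := fun x : B => r x) (hind.precomp Subtype.val_injective) (by fun_prop)
      (fun x => hlaw x) k
    simp only [happ]
    rw [h, hlamB]
  have hmeas : ∀ B : Set E, Measurable fun ω => η ω B := fun B => by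
    simp only [happ]
    exact measurable_tsum_natCast fun x => measurable_pi_apply _
  refine ⟨E → ℕ, inferInstance, P, η, inferInstance, fun ω => ?_, ?_, ?_, ?_, ?_⟩
  -- The atoms are indexed by `E`, which may be finite; an injection into `ℕ` and extension by zero
  -- give the required sequence of measures.
  · obtain ⟨e, he⟩ := exists_injective_nat E
    refine ⟨Function.extend e (fun x => (ω x : ℝ≥0∞) • Measure.dirac x) 0, fun i => ?_,
      (Measure.sum_extend_zero he _).symm⟩
    by_cases hi : ∃ x, e x = i
    · obtain ⟨x, rfl⟩ := hi
      rw [he.extend_apply]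
      refine ⟨⟨by simp⟩, fun B hB => ⟨if x ∈ B then ω x else 0, ?_⟩⟩
      by_cases hx : x ∈ B <;> simp [hx, Measure.dirac_apply' _ hB]
    · rw [Function.extend_apply' _ _ _ hi]
      exact ⟨inferInstanceAs (IsFiniteMeasure (0 : Measure E)), fun B _ => ⟨0, by simp⟩⟩
  · exact Measure.measurable_of_measurable_coe _ fun B _ => hmeas B
  · intro B _ hB k
    rw [hdist, if_neg hB]
  · intro B _ hB k
    rw [hdist, if_pos hB]
  · intro n B _ hdisj
    -- The value of `η` on `B i` is a function of the coordinates in `B i` only, and disjoint groups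
    -- of independent coordinates are independent.
    have h := iIndep_biSup_of_pairwise_disjoint
      (fun x => (measurable_pi_apply x).comap_le) hind.iIndep hdisj
    rw [iIndep_iff] at h
    rw [iIndepFun_iff_iIndep, iIndep_iff]
    intro s f hf
    refine h s fun i hi => ?_
    obtain ⟨t, ht, hft⟩ := hf i hi
    rw [← hft]
    simp only [happ]
    refine measurable_tsum_natCast (N := fun (x : B i) (ω : E → ℕ) => ω x)
      (fun x => Measurable.mono
        (comap_measurable fun ω : E → ℕ => ω (x : E)) ?_ le_rfl) ht
    exact le_biSup (fun x : E => MeasurableSpace.comap (fun ω : E → ℕ => ω x) inferInstance) x.2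

end Poisson

/-! ## Invariance and properness of the action -/

section Walls

theorem separates_smul_iff {Γ X : Type*} [Group Γ] [MulAction Γ X] (g : Γ) (W : Set (Set X))
    (x y : X) : Separates (g • W) (g • x) (g • y) ↔ Separates W x y := by
  constructor
  · rintro ⟨_, ⟨A, hA, rfl⟩, hx, hy⟩
    exact ⟨A, hA, Set.smul_mem_smul_set_iff.1 hx, fun h => hy (Set.smul_mem_smul_set_iff.2 h)⟩
  · rintro ⟨A, hA, hx, hy⟩
    exact ⟨g • A, Set.smul_mem_smul_set hA, Set.smul_mem_smul_set_iff.2 hx,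
      fun h => hy (Set.smul_mem_smul_set_iff.1 h)⟩

theorem MeasuredWalls.IsInvariantAction.preimage_sep {Γ : Type*} [Group Γ] {X : Type u}
    [MulAction Γ X] {M : MeasuredWalls X} (hM : M.IsInvariantAction Γ) (g : Γ) (x y : X) :
    (fun W : M.walls => (⟨g • W.1, hM.smul_mem g W.1 W.2⟩ : M.walls)) ⁻¹' M.sep (g • x) (g • y) =
      M.sep x y := by
  ext W
  exact separates_smul_iff g W.1 x y

theorem MeasuredWalls.measurableSet_sep' {X : Type u} (M : MeasuredWalls X) (x y : X) :
    MeasurableSet (M.sep x y) :=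
  M.measurableSet_sep x y

theorem MeasuredWalls.translateMeasure_apply {Γ : Type u} [Group Γ] (A : Finset Γ) (c : ℝ≥0)
    (B : Set (range (translateWall A))) : translateMeasure A c B =
      ∑' g : Γ, (c : ℝ≥0∞) * B.indicator 1 ⟨translateWall A g, g, rfl⟩ := by
  let _ : MeasurableSpace (range (translateWall A)) := ⊤
  have htop : ∀ s : Set (range (translateWall A)), MeasurableSet s := fun _ => trivial
  rw [translateMeasure, Measure.sum_apply _ (htop _)]
  refine tsum_congr fun g => ?_
  rw [Measure.smul_apply, Measure.dirac_apply' _ (htop _), ENNReal.smul_def, smul_eq_mul]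

theorem MeasuredWalls.IsInvariantAction.w_smul {Γ : Type*} [Group Γ] {X : Type u}
    [MulAction Γ X] {M : MeasuredWalls X} (hM : M.IsInvariantAction Γ) (g : Γ) (x y : X) :
    M.w (g • x) (g • y) = M.w x y := by
  rw [MeasuredWalls.w, MeasuredWalls.w, ← hM.preimage_sep g x y,
    (hM.measurePreserving g).measure_preimage (M.measurableSet_sep' _ _).nullMeasurableSet]

/-! ### The walls of a Følner sequence and the action on them -/

namespace FolnerSequence

open MeasuredWalls

variable {Γ : Type u} [Group Γ] (F : FolnerSequence Γ)

/-- Every factor carries its power set, hence so does the product. -/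
theorem measurableSet_walls (B : Set F.measuredWalls.walls) : MeasurableSet B :=
  MeasurableSpace.measurableSet_iInf.2 fun _ => trivial

/-- The mass of a wall of the `n`-th factor. -/
noncomputable def mass (n : ℕ+) : ℝ≥0 := (n : ℝ≥0) / ((F.A n).card : ℝ≥0)

theorem mass_mul_card (n : ℕ+) : (F.mass n : ℝ≥0∞) * ((F.A n).card : ℝ≥0∞) = (n : ℕ) := by
  have h : ((F.A n).card : ℝ≥0) ≠ 0 := by
    exact_mod_cast (F.A_nonempty n).card_pos.ne'
  rw [← ENNReal.coe_natCast, ← ENNReal.coe_mul, mass, div_mul_cancel₀ _ h]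
  simp

/-- The pull-back of the wall `{g (A n)⁻¹, (g (A n)⁻¹)ᶜ}` to the product. -/
noncomputable def wall (n : ℕ+) (g : Γ) : F.measuredWalls.walls :=
  liftWall F.factor (fun _ => (1 : Γ)) n ⟨translateWall (F.A n) g, g, rfl⟩

theorem exists_eq_wall (W : F.measuredWalls.walls) : ∃ n g, W = F.wall n g := by
  obtain ⟨_, n, _, ⟨g, rfl⟩, rfl⟩ := W
  exact ⟨n, g, rfl⟩

theorem separates_wall (n : ℕ+) (g : Γ) (x y : F.Space) :
    Separates (F.wall n g).1 x y ↔
      g ∈ (x.val n • (F.A n : Set Γ)) ∆ (y.val n • (F.A n : Set Γ)) :=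
  (separates_pullWall _ _ _ _ _ _).trans (separates_translateWall _ _ _ _)

/-- The diagonal action commutes with the projections and translation commutes with complements, so
on indices the action is left multiplication. -/
theorem smul_wall (k : Γ) (n : ℕ+) (g : Γ) : k • (F.wall n g).1 = (F.wall n (k * g)).1 := by
  have key : ∀ B : Set Γ, k • {x : F.Space | x.val n ∈ B} = {x : F.Space | x.val n ∈ k • B} := by
    intro B
    ext x
    rw [Set.mem_smul_set_iff_inv_smul_mem]
    exact (Set.mem_smul_set_iff_inv_smul_mem (a := k) (A := B) (x := x.val n)).symm
  have hc : ∀ B : Set Γ, {x : F.Space | x.val n ∈ Bᶜ} = {x : F.Space | x.val n ∈ B}ᶜ :=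
    fun B => rfl
  change k • ((fun A : Set Γ => {x : F.Space | x.val n ∈ A}) '' translateWall (F.A n) g) =
    (fun A : Set Γ => {x : F.Space | x.val n ∈ A}) '' translateWall (F.A n) (k * g)
  rw [translateWall, translateWall, image_pair, image_pair, ← image_smul, image_pair, key, key,
    Set.smul_set_compl, mul_smul]

/-- Summing over indices rather than walls respects multiplicities, so `wall` need not be injective
and invariance of `μ` becomes a reindexing by `g ↦ k * g`. -/
theorem measure_apply (B : Set F.measuredWalls.walls) :
    F.measuredWalls.μ B =
      ∑' (n : ℕ+) (g : Γ), (F.mass n : ℝ≥0∞) * B.indicator 1 (F.wall n g) := by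
  have h1 : F.measuredWalls.μ B = ∑' n : ℕ+, (F.factor n).μ
      (liftWall F.factor (fun _ => (1 : Γ)) n ⁻¹' B) := by
    refine (Measure.sum_apply _ (F.measurableSet_walls B)).trans (tsum_congr fun n => ?_)
    refine Measure.map_apply ?_ (F.measurableSet_walls B)
    exact fun s _ => trivial
  rw [h1]
  exact tsum_congr fun n => MeasuredWalls.translateMeasure_apply _ _ _

theorem smul_mem_walls (k : Γ) (W : Set (Set F.Space)) (hW : W ∈ F.measuredWalls.walls) :
    k • W ∈ F.measuredWalls.walls := by
  obtain ⟨n, g, h⟩ := F.exists_eq_wall ⟨W, hW⟩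
  have h' : W = (F.wall n g).1 := congrArg Subtype.val h
  rw [h', F.smul_wall]
  exact (F.wall n (k * g)).2

theorem isInvariantAction : F.measuredWalls.IsInvariantAction Γ where
  smul_mem := F.smul_mem_walls
  measurePreserving k := by
    refine ⟨fun _ _ => F.measurableSet_walls _, Measure.ext fun B hB => ?_⟩
    rw [Measure.map_apply (fun _ _ => F.measurableSet_walls _) hB, F.measure_apply,
      F.measure_apply]
    refine tsum_congr fun n => ?_
    have e : ∀ g : Γ, 
        (⟨k • (F.wall n g).1, F.smul_mem_walls k _ (F.wall n g).2⟩ : F.measuredWalls.walls) =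
          F.wall n (k * g) :=
      fun g => Subtype.ext (F.smul_wall k n g)
    rw [← (Equiv.mulLeft k).tsum_eq fun g => (F.mass n : ℝ≥0∞) * B.indicator 1 (F.wall n g)]
    refine tsum_congr fun g => ?_
    rw [Equiv.coe_mulLeft, ← e]
    rfl

/-- The walls of the `n`-th factor one of whose halves is a finite set containing `v`. -/
def wallsAround (n : ℕ+) (v : Γ) : Set F.measuredWalls.walls := F.wall n '' (v • (F.A n : Set Γ))

/-- The `|A n|` indices in `v • A n` contribute `n / |A n|` each. Only an inequality holds in
general, as other indices may yield the same walls. -/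
theorem le_measure_wallsAround (n : ℕ+) (v : Γ) :
    ((n : ℕ) : ℝ≥0∞) ≤ F.measuredWalls.μ (F.wallsAround n v) := by
  classical
  rw [F.measure_apply]
  refine le_trans ?_ (ENNReal.le_tsum n)
  refine le_trans ?_ (ENNReal.sum_le_tsum (v • F.A n))
  rw [← F.mass_mul_card, Finset.sum_congr rfl (g := fun _ => (F.mass n : ℝ≥0∞))]
  · rw [Finset.sum_const, Finset.card_smul_finset, nsmul_eq_mul, mul_comm]
  · intro g hg
    rw [Set.indicator_of_mem, Pi.one_apply, mul_one]
    refine mem_image_of_mem _ ?_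
    rwa [← Finset.coe_smul_finset]

theorem smul_basePoint_val (g : Γ) (n : ℕ+) : (g • F.basePoint).val n = g := mul_one g

theorem isProperAction : F.measuredWalls.IsProperAction Γ where
  smul_mem := F.isInvariantAction.smul_mem
  w_smul := F.isInvariantAction.w_smul
  proper := by
    refine ⟨F.basePoint, ENNReal.tendsto_nhds_top fun k => ?_⟩
    -- With `n = k + 1`, for `g` outside the finite set `A n / A n` the sets `A n` and `g • A n` are
    -- disjoint, so all walls around `1` separate the two base points and the distance is at least
    -- `k + 1`.
    refine (((F.A k.succPNat).finite_toSet.div (F.A k.succPNat).finite_toSet).subset ?_)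
    intro g hg
    by_contra hdisj
    refine hg ?_
    have hk : (k : ℝ≥0∞) < ((k.succPNat : ℕ) : ℝ≥0∞) := by
      exact_mod_cast Nat.lt_succ_self k
    refine hk.trans_le ((F.le_measure_wallsAround k.succPNat 1).trans (measure_mono ?_))
    rintro _ ⟨a, ha, rfl⟩
    refine (F.separates_wall _ _ _ _).2 (Or.inl ⟨ha, ?_⟩)
    rw [F.smul_basePoint_val, Set.mem_smul_set_iff_inv_smul_mem]
    intro hb
    rw [one_smul] at ha
    exact hdisj ⟨a, ha, g⁻¹ • a, hb, by simp⟩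

theorem countable_walls [Countable Γ] : Countable F.measuredWalls.walls :=
  Function.Surjective.countable (f := fun q : ℕ+ × Γ => F.wall q.1 q.2) fun W => by
    obtain ⟨n, g, rfl⟩ := F.exists_eq_wall W
    exact ⟨(n, g), rfl⟩

/-- Since `A n` is finite and non-empty and `Γ` is infinite, both halves of the wall meet the orbit
of the base point; the wall thus belongs to a separating set, which has finite measure. -/
theorem measure_singleton_ne_top [Infinite Γ] (W : F.measuredWalls.walls) :
    F.measuredWalls.μ {W} ≠ ∞ := by
  obtain ⟨n, g, rfl⟩ := F.exists_eq_wall W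
  obtain ⟨a, ha⟩ := F.A_nonempty n
  obtain ⟨b, hb⟩ := Infinite.exists_notMem_finset (F.A n)
  refine ne_top_of_le_ne_top (F.measuredWalls.sep_ne_top ((g * a⁻¹) • F.basePoint)
    ((g * b⁻¹) • F.basePoint)) (measure_mono ?_)
  rw [singleton_subset_iff]
  refine (F.separates_wall _ _ _ _).2 (Or.inl ⟨?_, ?_⟩)
  · rw [F.smul_basePoint_val, Set.mem_smul_set_iff_inv_smul_mem]
    simpa using ha
  · rw [F.smul_basePoint_val, Set.mem_smul_set_iff_inv_smul_mem]
    simpa using hb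

theorem exists_poisson [Infinite Γ] [Countable Γ] {c : ℝ≥0∞} (hc : c ≠ ∞) :
    ∃ (Ω : Type u) (_ : MeasurableSpace Ω) (P : Measure Ω) (η : Ω → Measure F.measuredWalls.walls),
      IsPoissonProcess P (c • F.measuredWalls.μ) η := by
  have := F.countable_walls
  have : MeasurableSingletonClass F.measuredWalls.walls := ⟨fun _ => F.measurableSet_walls _⟩
  refine _root_.exists_poisson _ fun W => ?_
  rw [Measure.smul_apply, smul_eq_mul]
  exact ENNReal.mul_ne_top hc (F.measure_singleton_ne_top W)

end FolnerSequence

end Walls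

/-! ## The percolation associated with a Poisson process of walls -/

section Percolation

theorem measurableSet_finset_subset {α : Type*} (s : Finset α) :
    MeasurableSet {ω : Set α | ↑s ⊆ ω} := by
  have : {ω : Set α | ↑s ⊆ ω} = ⋂ a ∈ s, {ω | a ∈ ω} := by
    ext ω
    simp [Set.subset_def]
  exact this ▸ Finset.measurableSet_biInter s fun a _ =>
    measurableSet_setOfPred.2 (measurable_set_mem a)

/-- Finite measures on a power set agree if they agree on all events `{ω | s ⊆ ω}`, `s` finite. -/
theorem Set.measure_ext_of_finset_subset {α : Type*} {Q R : Measure (Set α)} [IsFiniteMeasure Q]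
    (h : ∀ s : Finset α, Q {ω | ↑s ⊆ ω} = R {ω | ↑s ⊆ ω}) : Q = R := by
  classical
  -- These events form a π-system, by taking unions of the finite sets, and singletons already
  -- generate the σ-algebra.
  refine ext_of_generate_finite (range fun s : Finset α => {ω : Set α | ↑s ⊆ ω}) ?_ ?_ ?_ ?_
  · refine le_antisymm ?_ (MeasurableSpace.generateFrom_le ?_)
    · let m' : MeasurableSpace (Set α) :=
        MeasurableSpace.generateFrom (range fun s : Finset α => {ω : Set α | ↑s ⊆ ω})
      have hid : @Measurable (Set α) (Set α) m' Set.instMeasurableSpace id := by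
        refine measurable_set_iff.2 fun a => measurableSet_setOfPred.1 ?_
        refine MeasurableSpace.measurableSet_generateFrom ⟨{a}, ?_⟩
        ext ω
        simp
      exact fun B hB => hid hB
    · rintro _ ⟨s, rfl⟩
      exact measurableSet_finset_subset s
  · rintro _ ⟨s, rfl⟩ _ ⟨t, rfl⟩ -
    refine ⟨s ∪ t, ?_⟩
    ext ω
    simp
  · rintro _ ⟨s, rfl⟩
    exact h s
  · simpa using h ∅

/-! ### Void probabilities -/

theorem IsPoissonProcess.measure_eq_zero {Ω : Type*} [MeasurableSpace Ω] {P : Measure Ω}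
    {E : Type*} [MeasurableSpace E] {lam : Measure E} {η : Ω → Measure E}
    (h : IsPoissonProcess P lam η) {B : Set E} (hB : MeasurableSet B) (hfin : lam B ≠ ∞) :
    P {ω | η ω B = 0} = ENNReal.ofReal (Real.exp (-(lam B).toReal)) := by
  have := h.poisson B hB hfin 0
  simpa using this

theorem IsPoissonProcess.measure_eq_zero_le {Ω : Type*} [MeasurableSpace Ω] {P : Measure Ω}
    {E : Type*} [MeasurableSpace E] {lam : Measure E} {η : Ω → Measure E}
    (h : IsPoissonProcess P lam η) {B : Set E} (hB : MeasurableSet B) {x : ℝ}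
    (hx : ENNReal.ofReal x ≤ lam B) : P {ω | η ω B = 0} ≤ ENNReal.ofReal (Real.exp (-x)) := by
  by_cases hfin : lam B = ∞
  · have := h.poisson_top B hB hfin 0
    rw [Nat.cast_zero] at this
    rw [this]
    exact zero_le
  · rw [h.measure_eq_zero hB hfin]
    refine ENNReal.ofReal_le_ofReal (Real.exp_le_exp.2 (neg_le_neg ?_))
    exact (ENNReal.ofReal_le_iff_le_toReal hfin).1 hx

/-! ### Edges, separating walls and invariance of the percolation -/

variable {Γ : Type*} [Group Γ] {X : Type u} [MulAction Γ X]

/-- The walls separating the images of the base point under the end points of the edge `e`. -/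
def MeasuredWalls.edgeSep (M : MeasuredWalls X) (x₀ : X) (e : Sym2 Γ) : Set M.walls :=
  {W | ∃ g h : Γ, e = s(g, h) ∧ W ∈ M.sep (g • x₀) (h • x₀)}

namespace MeasuredWalls

variable (M : MeasuredWalls X) (x₀ : X)

theorem edgeSep_mk (g h : Γ) : M.edgeSep x₀ s(g, h) = M.sep (g • x₀) (h • x₀) := by
  refine Subset.antisymm ?_ fun W hW => ⟨g, h, rfl, hW⟩
  rintro W ⟨a, b, hab, hW⟩
  rcases Sym2.eq_iff.1 hab with ⟨rfl, rfl⟩ | ⟨rfl, rfl⟩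
  · exact hW
  · rwa [M.sep_comm]

theorem measurableSet_edgeSep (e : Sym2 Γ) : MeasurableSet (M.edgeSep x₀ e) := by
  induction e with
  | _ g h =>
    rw [edgeSep_mk]
    exact M.measurableSet_sep' _ _

theorem measure_edgeSep_ne_top (e : Sym2 Γ) : M.μ (M.edgeSep x₀ e) ≠ ∞ := by
  induction e with
  | _ g h =>
    rw [edgeSep_mk]
    exact M.sep_ne_top _ _

variable {M} in
theorem IsInvariantAction.preimage_edgeSep (hM : M.IsInvariantAction Γ) (k : Γ) (e : Sym2 Γ) :
    (fun W : M.walls => (⟨k • W.1, hM.smul_mem k W.1 W.2⟩ : M.walls)) ⁻¹'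
      M.edgeSep x₀ (Sym2.map (fun x => k * x) e) = M.edgeSep x₀ e := by
  induction e with
  | _ g h =>
    rw [Sym2.map_mk, edgeSep_mk, edgeSep_mk, mul_smul, mul_smul, hM.preimage_sep]

end MeasuredWalls

variable {M : MeasuredWalls X} {x₀ : X} {G : SimpleGraph Γ}

theorem mem_wallPercolation {η : Measure M.walls} {e : Sym2 Γ} :
    e ∈ wallPercolation G M x₀ η ↔ e ∈ G.edgeSet ∧ η (M.edgeSep x₀ e) = 0 := by
  refine and_congr_right fun _ => ?_
  induction e with
  | _ g h =>
    rw [MeasuredWalls.edgeSep_mk]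
    refine ⟨fun H => H g h rfl, fun H a b hab => ?_⟩
    rwa [← MeasuredWalls.edgeSep_mk, ← hab, MeasuredWalls.edgeSep_mk]

/-- States of different edges are dependent, but joint openness of finitely many edges is a single
void event, with an explicit Poisson probability. -/
theorem subset_wallPercolation {η : Measure M.walls} {s : Finset (Sym2 Γ)} :
    ↑s ⊆ wallPercolation G M x₀ η ↔
      ↑s ⊆ G.edgeSet ∧ η (⋃ e ∈ s, M.edgeSep x₀ e) = 0 := by
  have hu : η (⋃ e ∈ s, M.edgeSep x₀ e) = 0 ↔ ∀ e ∈ s, η (M.edgeSep x₀ e) = 0 :=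
    measure_biUnion_null_iff s.countable_toSet
  rw [hu]
  simp only [Set.subset_def, mem_wallPercolation, Finset.mem_coe]
  exact ⟨fun h => ⟨fun e he => (h e he).1, fun e he => (h e he).2⟩,
    fun h e he => ⟨h.1 e he, h.2 e he⟩⟩

theorem measurable_wallPercolation {Ω : Type*} [MeasurableSpace Ω] {η : Ω → Measure M.walls}
    (hη : Measurable η) : Measurable fun ω => wallPercolation G M x₀ (η ω) := by
  refine measurable_set_iff.2 fun e => measurableSet_setOfPred.1 ?_
  simp only [mem_wallPercolation]
  by_cases he : e ∈ G.edgeSet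
  · simp only [he, true_and]
    exact (Measure.measurable_coe (M.measurableSet_edgeSep x₀ e)).comp hη
      (measurableSet_singleton 0)
  · simp [he]

theorem mem_image_sym2_mul {k : Γ} {ω : Set (Sym2 Γ)} {e : Sym2 Γ} :
    e ∈ Sym2.map (fun x => k * x) '' ω ↔ Sym2.map (fun x => k⁻¹ * x) e ∈ ω := by
  constructor
  · rintro ⟨e', he', rfl⟩
    simpa [Sym2.map_map, Function.comp_def] using he'
  · intro he
    exact ⟨_, he, by simp [Sym2.map_map]⟩

theorem measurable_image_sym2_mul (k : Γ) :
    Measurable fun ω : Set (Sym2 Γ) => Sym2.map (fun x => k * x) '' ω := by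
  refine measurable_set_iff.2 fun e => ?_
  simp only [mem_image_sym2_mul]
  exact measurable_set_mem _

/-- The percolation associated with a Poisson process whose intensity is proportional to the
measure of an invariant space with measured walls is invariant. -/
theorem IsPoissonProcess.isInvariantBondPercolation [Countable Γ] {Ω : Type*} [MeasurableSpace Ω]
    {P : Measure Ω} {c : ℝ≥0∞} (hc : c ≠ ∞) {η : Ω → Measure M.walls}
    (h : IsPoissonProcess P (c • M.μ) η) (hM : M.IsInvariantAction Γ)
    (hG : ∀ k g h : Γ, G.Adj (k * g) (k * h) ↔ G.Adj g h) :
    IsInvariantBondPercolation G (P.map fun ω => wallPercolation G M x₀ (η ω)) := by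
  classical
  have hP := h.isProbabilityMeasure
  have hmeas : Measurable fun ω => wallPercolation G M x₀ (η ω) :=
    measurable_wallPercolation h.measurable
  have hQ : IsProbabilityMeasure (P.map fun ω => wallPercolation G M x₀ (η ω)) :=
    Measure.isProbabilityMeasure_map hmeas.aemeasurable
  have hms : ∀ s : Finset (Sym2 Γ), MeasurableSet (⋃ e ∈ s, M.edgeSep x₀ e) := fun s =>
    Finset.measurableSet_biUnion s fun e _ => M.measurableSet_edgeSep x₀ e
  have hfin : ∀ s : Finset (Sym2 Γ), (c • M.μ) (⋃ e ∈ s, M.edgeSep x₀ e) ≠ ∞ := fun s => by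
    rw [Measure.smul_apply, smul_eq_mul]
    refine ENNReal.mul_ne_top hc (ne_top_of_le_ne_top ?_ (measure_biUnion_finset_le s _))
    exact ENNReal.sum_ne_top.2 fun e _ => M.measure_edgeSep_ne_top x₀ e
  have hval : ∀ s : Finset (Sym2 Γ),
      (P.map fun ω => wallPercolation G M x₀ (η ω)) {ω | ↑s ⊆ ω} =
        if ↑s ⊆ G.edgeSet then ENNReal.ofReal
          (Real.exp (-((c • M.μ) (⋃ e ∈ s, M.edgeSep x₀ e)).toReal)) else 0 := by
    intro s
    rw [Measure.map_apply hmeas (measurableSet_finset_subset s)]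
    simp only [preimage_ofPred_eq, subset_wallPercolation]
    split_ifs with hs
    · simp only [hs, true_and]
      exact h.measure_eq_zero (hms s) (hfin s)
    · simp [hs]
  refine ⟨hQ, ?_, fun k => ?_⟩
  · have : ∀ e : Sym2 Γ, ∀ᵐ ω ∂P.map fun ω => wallPercolation G M x₀ (η ω),
        e ∈ ω → e ∈ G.edgeSet := by
      intro e
      by_cases he : e ∈ G.edgeSet
      · exact Eventually.of_forall fun _ _ => he
      · rw [ae_map_iff hmeas.aemeasurable]
        · exact Eventually.of_forall fun ω hω => hω.1
        · simp only [he, imp_false]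
          exact measurableSet_setOfPred.2 (measurable_set_notMem e)
    filter_upwards [ae_all_iff.2 this] with ω hω e he using hω e he
  · have := Measure.isProbabilityMeasure_map (μ := P.map fun ω => wallPercolation G M x₀ (η ω))
      (measurable_image_sym2_mul k).aemeasurable
    refine Set.measure_ext_of_finset_subset fun s => ?_
    rw [Measure.map_apply (measurable_image_sym2_mul k) (measurableSet_finset_subset s)]
    have himg : (fun ω : Set (Sym2 Γ) => Sym2.map (fun x => k * x) '' ω) ⁻¹' {ω | ↑s ⊆ ω} =
        {ω | ↑(s.image (Sym2.map fun x => k⁻¹ * x)) ⊆ ω} := by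
      ext ω
      change (s : Set (Sym2 Γ)) ⊆ _ '' ω ↔
        ((s.image (Sym2.map fun x => k⁻¹ * x) : Finset (Sym2 Γ)) : Set (Sym2 Γ)) ⊆ ω
      rw [Finset.coe_image, image_subset_iff]
      exact forall₂_congr fun e _ => mem_image_sym2_mul
    rw [himg, hval, hval]
    refine if_congr ?_ ?_ rfl
    · simp only [Set.subset_def, Finset.coe_image, Set.forall_mem_image]
      refine forall₂_congr fun e _ => ?_
      induction e with
      | _ g h => exact hG k⁻¹ g h
    -- Translation by `k⁻¹` preserves `μ` and pulls the walls separating the translated edges back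
    -- to those separating the edges of `s`.
    · congr 4
      rw [Measure.smul_apply, Measure.smul_apply,
        ← (hM.measurePreserving k⁻¹).measure_preimage (hms _).nullMeasurableSet]
      congr 2
      simp only [preimage_iUnion, Finset.set_biUnion_finset_image, hM.preimage_edgeSep]

end Percolation

/-! ### Finiteness of the clusters -/

namespace FolnerSequence

variable {Γ : Type u} [Group Γ] (F : FolnerSequence Γ)

/-- A cluster that meets a hit wall around one of its vertices is finite. -/
theorem noInfiniteCluster_of_wallsAround (G : SimpleGraph Γ) (η : Measure F.measuredWalls.walls)
    (h : ∀ v, ∃ n, η (F.wallsAround n v) ≠ 0) :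
    NoInfiniteCluster (wallPercolation G F.measuredWalls F.basePoint η) := by
  intro C
  induction C using SimpleGraph.ConnectedComponent.ind with
  | _ v =>
    obtain ⟨n, hn⟩ := h v
    -- `wallsAround n v` is a finite union of single walls, so one of them is hit.
    have hex : ∃ a ∈ v • (F.A n : Set Γ), η {F.wall n a} ≠ 0 := by
      by_contra! hcon
      refine hn ?_
      rw [wallsAround, ← biUnion_of_singleton (F.wall n '' _), biUnion_image,
        measure_biUnion_null_iff (F.A n).finite_toSet.smul_set.countable]
      exact hcon
    obtain ⟨a, hav, ha⟩ := hex
    have hstep : ∀ u u', (SimpleGraph.fromEdgeSet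
        (wallPercolation G F.measuredWalls F.basePoint η)).Adj u u' →
        a ∈ u • (F.A n : Set Γ) → a ∈ u' • (F.A n : Set Γ) := by
      intro u u' hadj hu
      by_contra hu'
      have h0 := ((SimpleGraph.fromEdgeSet_adj _).1 hadj).1.2 u u' rfl
      refine ha (measure_mono_null (singleton_subset_iff.2 ?_) h0)
      refine (F.separates_wall _ _ _ _).2 (Or.inl ⟨?_, ?_⟩) <;> rwa [F.smul_basePoint_val]
    -- The condition `a ∈ u • A n` propagates along open edges and confines the cluster to the
    -- finite half `a (A n)⁻¹`.
    refine ((F.A n).finite_toSet.image fun b => a * b⁻¹).subset fun u hu => ?_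
    rw [SimpleGraph.ConnectedComponent.mem_supp_iff, SimpleGraph.ConnectedComponent.eq] at hu
    have hreach := (SimpleGraph.reachable_iff_reflTransGen v u).1 hu.symm
    clear hu
    have hau : a ∈ u • (F.A n : Set Γ) := by
      induction hreach with
      | refl => exact hav
      | tail _ hadj ih => exact hstep _ _ hadj ih
    rw [Set.mem_smul_set_iff_inv_smul_mem] at hau
    exact ⟨_, hau, by simp⟩

/-- Missing the walls around `v` in every factor implies missing them in the `n`-th one, which has
probability at most `exp (-c n)`; letting `n → ∞` needs no independence between factors.
Countability of `Γ` handles all vertices at once. -/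
theorem ae_noInfiniteCluster [Countable Γ] (G : SimpleGraph Γ) {Ω : Type*} [MeasurableSpace Ω]
    {P : Measure Ω} {c : ℝ} (hc : 0 < c) {η : Ω → Measure F.measuredWalls.walls}
    (h : IsPoissonProcess P (ENNReal.ofReal c • F.measuredWalls.μ) η) :
    ∀ᵐ ω ∂P, NoInfiniteCluster (wallPercolation G F.measuredWalls F.basePoint (η ω)) := by
  have key : ∀ v : Γ, ∀ᵐ ω ∂P, ∃ n, η ω (F.wallsAround n v) ≠ 0 := by
    intro v
    have hle : ∀ n : ℕ+, P {ω | ¬ ∃ n, η ω (F.wallsAround n v) ≠ 0} ≤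
        ENNReal.ofReal (Real.exp (-(c * (n : ℕ)))) := by
      intro n
      refine (measure_mono fun ω hω => ?_).trans
        (h.measure_eq_zero_le (F.measurableSet_walls (F.wallsAround n v)) (x := c * (n : ℕ)) ?_)
      · by_contra hne
        exact hω ⟨n, hne⟩
      · rw [Measure.smul_apply, smul_eq_mul, ENNReal.ofReal_mul hc.le, ENNReal.ofReal_natCast]
        gcongr
        exact F.le_measure_wallsAround n v
    have hlim : Tendsto (fun n : ℕ => ENNReal.ofReal (Real.exp (-(c * (n.succPNat : ℕ))))) atTop
        (𝓝 0) := by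
      rw [← ENNReal.ofReal_zero]
      refine (ENNReal.continuous_ofReal.tendsto _).comp (Real.tendsto_exp_neg_atTop_nhds_zero.comp ?_)
      exact (tendsto_natCast_atTop_atTop.comp (tendsto_add_atTop_nat 1)).const_mul_atTop hc
    exact le_antisymm (ge_of_tendsto' hlim fun n => hle n.succPNat) zero_le
  filter_upwards [ae_all_iff.2 key] with ω hω
  exact F.noInfiniteCluster_of_wallsAround G (η ω) hω

end FolnerSequence

/-! ## The expected degree -/

section Degree

theorem mulCayley_adj_mul_left {Γ : Type*} [Group Γ] (S : Set Γ) (k g h : Γ) :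
    (SimpleGraph.mulCayley S).Adj (k * g) (k * h) ↔ (SimpleGraph.mulCayley S).Adj g h := by
  simp [SimpleGraph.mulCayley_adj', mul_assoc]

theorem finite_neighborSet_mulCayley {Γ : Type*} [Group Γ] (S : Finset Γ) :
    ((SimpleGraph.mulCayley (S : Set Γ)).neighborSet 1).Finite := by
  refine (S.finite_toSet.union S.finite_toSet.inv).subset fun x hx => ?_
  obtain ⟨-, g, hg, h | h⟩ := (SimpleGraph.mulCayley_adj' _ _ _).1 hx
  · left
    rwa [← h, one_mul]
  · right
    rw [Set.mem_inv, inv_eq_of_mul_eq_one_right h.symm]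
    exact hg

/-- The strict bound on the expected degree would fail at degree zero; a non-trivial group is not
generated by its identity. -/
theorem vertexDegree_mulCayley_pos {Γ : Type*} [Group Γ] [Nontrivial Γ] (S : Finset Γ)
    (hS : Subgroup.closure (S : Set Γ) = ⊤) :
    0 < vertexDegree (SimpleGraph.mulCayley (S : Set Γ)) 1 := by
  have hex : ∃ s ∈ S, s ≠ 1 := by
    by_contra! hcon
    have : Subgroup.closure (S : Set Γ) ≤ ⊥ := (Subgroup.closure_le _).2 fun s hs => hcon s hs
    rw [hS, top_le_iff] at this
    exact bot_ne_top this
  obtain ⟨s, hs, hs1⟩ := hex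
  refine (Set.ncard_pos (finite_neighborSet_mulCayley S)).2 ⟨s, ?_⟩
  exact (SimpleGraph.mulCayley_adj' _ _ _).2 ⟨hs1.symm, s, hs, Or.inl (one_mul s)⟩

/-- The expected degree of a vertex in the percolation associated with a Poisson process of
walls. -/
theorem IsPoissonProcess.integral_vertexDegree {Γ : Type*} [Group Γ] {X : Type u} [MulAction Γ X]
    {M : MeasuredWalls X} {x₀ : X} {G : SimpleGraph Γ} {Ω : Type*} [MeasurableSpace Ω]
    {P : Measure Ω} {c : ℝ} (hc : 0 ≤ c) {η : Ω → Measure M.walls}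
    (h : IsPoissonProcess P (ENNReal.ofReal c • M.μ) η) (v : Γ) (hv : (G.neighborSet v).Finite) :
    ∫ ω, (vertexDegree (SimpleGraph.fromEdgeSet (wallPercolation G M x₀ (η ω))) v : ℝ) ∂P =
      ∑ s ∈ hv.toFinset, Real.exp (-(c * (M.w (v • x₀) (s • x₀)).toReal)) := by
  classical
  have hP := h.isProbabilityMeasure
  have hset : ∀ s : Γ, MeasurableSet {ω | η ω (M.sep (v • x₀) (s • x₀)) = 0} := fun s =>
    (Measure.measurable_coe (M.measurableSet_sep' _ _)).comp h.measurable
      (measurableSet_singleton 0)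
  have hdeg : ∀ ω, (vertexDegree (SimpleGraph.fromEdgeSet
      (wallPercolation G M x₀ (η ω))) v : ℝ) =
      ∑ s ∈ hv.toFinset, {ω | η ω (M.sep (v • x₀) (s • x₀)) = 0}.indicator (fun _ => (1 : ℝ)) ω := by
    intro ω
    have e : (SimpleGraph.fromEdgeSet (wallPercolation G M x₀ (η ω))).neighborSet v =
        ↑(hv.toFinset.filter fun s => η ω (M.sep (v • x₀) (s • x₀)) = 0) := by
      ext s
      rw [SimpleGraph.mem_neighborSet, SimpleGraph.fromEdgeSet_adj, mem_wallPercolation,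
        MeasuredWalls.edgeSep_mk, SimpleGraph.mem_edgeSet]
      simp only [Finset.coe_filter, Finite.mem_toFinset, SimpleGraph.mem_neighborSet,
        mem_ofPred_eq]
      exact ⟨fun H => H.1, fun H => ⟨H, H.1.ne⟩⟩
    rw [vertexDegree, e, Set.ncard_coe_finset, Finset.card_filter]
    push_cast
    exact Finset.sum_congr rfl fun s _ => by
      simp [Set.indicator_apply]
  simp only [hdeg]
  rw [integral_finsetSum _ fun s _ => (integrable_const (1 : ℝ)).indicator (hset s)]
  refine Finset.sum_congr rfl fun s _ => ?_
  have hm : (ENNReal.ofReal c • M.μ) (M.sep (v • x₀) (s • x₀)) =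
      ENNReal.ofReal c * M.w (v • x₀) (s • x₀) := rfl
  rw [integral_indicator_const _ (hset s), smul_eq_mul, mul_one, measureReal_def,
    h.measure_eq_zero (M.measurableSet_sep' _ _)
      (hm ▸ ENNReal.mul_ne_top ENNReal.ofReal_ne_top (M.sep_ne_top _ _)),
    ENNReal.toReal_ofReal (Real.exp_nonneg _), hm, ENNReal.toReal_mul, ENNReal.toReal_ofReal hc]

/-- The sum is continuous in `p` and equals `s.card` at `p = 1`, so the inequality persists slightly
to the left of `1`. -/
theorem exists_lt_sum_exp {ι : Type*} (s : Finset ι) (hs : s.Nonempty) (d : ι → ℝ) {α : ℝ}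
    (hα : α < 1) :
    ∃ p ∈ Ioo (0 : ℝ) 1, α * s.card < ∑ i ∈ s, Real.exp (-((1 - p) * d i)) := by
  have hcont : Continuous fun p : ℝ => ∑ i ∈ s, Real.exp (-((1 - p) * d i)) := by fun_prop
  have hlt : α * s.card < ∑ i ∈ s, Real.exp (-((1 - 1) * d i)) := by
    have : (0 : ℝ) < s.card := by exact_mod_cast hs.card_pos
    simp only [sub_self, zero_mul, neg_zero, Real.exp_zero, Finset.sum_const, nsmul_eq_mul, mul_one]
    nlinarith
  have h1 := (hcont.tendsto 1).eventually (lt_mem_nhds hlt)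
  obtain ⟨p, hp, hp'⟩ := ((h1.filter_mono nhdsWithin_le_nhds).and
    (Ioo_mem_nhdsLT (zero_lt_one (α := ℝ)))).exists
  exact ⟨p, hp', hp⟩

end Degree

/-! ### The main theorem -/

theorem proposition1p1 {Γ : Type u} [Group Γ] [Infinite Γ] (hΓ : IsAmenable Γ)
    (S : Finset Γ) (hS_symm : ∀ s ∈ S, s⁻¹ ∈ S) (hS_gen : Subgroup.closure (S : Set Γ) = ⊤) :
    -- Følner sequences exist, for every exhaustion
    (∃ K : ℕ+ → Finset Γ, IsExhaustion K) ∧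
    (∀ K : ℕ+ → Finset Γ, IsExhaustion K → ∃ F : FolnerSequence Γ, F.K = K) ∧
    ∀ F : FolnerSequence Γ,
      -- the action on the associated space with measured walls is invariant and proper
      F.measuredWalls.IsInvariantAction Γ ∧ F.measuredWalls.IsProperAction Γ ∧
      (∀ p ∈ Ioo (0 : ℝ) 1,
        -- the Poisson process exists
        (∃ (Ω : Type u) (_ : MeasurableSpace Ω) (P : Measure Ω) (η : Ω → Measure F.measuredWalls.walls),
          IsPoissonProcess P (ENNReal.ofReal (1 - p) • F.measuredWalls.μ) η) ∧
        -- the percolation is invariant and has almost surely no infinite cluster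
        ∀ (Ω : Type v) (_ : MeasurableSpace Ω) (P : Measure Ω) (η : Ω → Measure F.measuredWalls.walls),
          IsPoissonProcess P (ENNReal.ofReal (1 - p) • F.measuredWalls.μ) η →
            IsInvariantBondPercolation (SimpleGraph.mulCayley (S : Set Γ))
              (P.map fun ω => wallPercolation (SimpleGraph.mulCayley (S : Set Γ))
                F.measuredWalls F.basePoint (η ω)) ∧
            ∀ᵐ ω ∂P, NoInfiniteCluster (wallPercolation (SimpleGraph.mulCayley (S : Set Γ))
              F.measuredWalls F.basePoint (η ω))) ∧
      -- the expected degree is arbitrarily close to the full degree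
      ∀ α : ℝ, α < 1 → ∃ p ∈ Ioo (0 : ℝ) 1,
        ∀ (Ω : Type v) (_ : MeasurableSpace Ω) (P : Measure Ω) (η : Ω → Measure F.measuredWalls.walls),
          IsPoissonProcess P (ENNReal.ofReal (1 - p) • F.measuredWalls.μ) η →
            α * (vertexDegree (SimpleGraph.mulCayley (S : Set Γ)) 1 : ℝ) <
              ∫ ω, (vertexDegree (SimpleGraph.fromEdgeSet
                (wallPercolation (SimpleGraph.mulCayley (S : Set Γ))
                  F.measuredWalls F.basePoint (η ω))) 1 : ℝ) ∂P := by
  have hcount : Countable Γ := countable_of_closure_finset_eq_top S hS_gen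
  refine ⟨exists_isExhaustion Γ, hΓ.exists_folnerSequence, fun F => ⟨F.isInvariantAction,
    F.isProperAction, fun p hp => ⟨F.exists_poisson ENNReal.ofReal_ne_top, ?_⟩, ?_⟩⟩
  · intro Ω _ P η hη
    exact ⟨hη.isInvariantBondPercolation ENNReal.ofReal_ne_top F.isInvariantAction
      (mulCayley_adj_mul_left _), F.ae_noInfiniteCluster _ (sub_pos.2 hp.2) hη⟩
  · intro α hα
    have hfin := finite_neighborSet_mulCayley S
    have hdeg : vertexDegree (SimpleGraph.mulCayley (S : Set Γ)) 1 = hfin.toFinset.card :=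
      Set.ncard_eq_toFinset_card _ hfin
    have hne : hfin.toFinset.Nonempty := by
      rw [← Finset.card_pos, ← hdeg]
      exact vertexDegree_mulCayley_pos S hS_gen
    -- The choice of `p` involves only the wall distances from the base point to its translates by
    -- neighbours of `1`, so it serves every Poisson process.
    obtain ⟨p, hp, hlt⟩ := exists_lt_sum_exp hfin.toFinset hne
      (fun s => (F.measuredWalls.w ((1 : Γ) • F.basePoint) (s • F.basePoint)).toReal) hα
    refine ⟨p, hp, fun Ω _ P η hη => ?_⟩
    rw [hη.integral_vertexDegree (sub_nonneg.2 hp.2.le) 1 hfin, hdeg]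
    exact hlt
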